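/- Let $k$ be a field, $q$ an indeterminate, $k_q=k[q,q^{-1}]$, and let $r,s\ge 0$, $n=r+s$. Let $k_q\langle a_{ij}\rangle$ be the free algebra on $a_{ij}$, $1\le i,j\le n$, and let $I_M$ be the two-sided ideal generated by the Manin relations $$a_{ij}a_{il}=q^{-1}a_{il}a_{ij},\quad a_{ji}a_{li}=q^{-1}a_{li}a_{ji}\quad(j<l),$$ $$a_{ij}a_{ml}=a_{ml}a_{ij}\quad(i<m,\ j>l\ \text{ or }\ i>m,\ j<l),$$ $$a_{ij}a_{ml}-a_{ml}a_{ij}=(q^{-1}-q)\,a_{mj}a_{il}\quad(i<m,\ j<l).$$ Write $\equiv$ for congruence modulo $I_M$. For increasing sequences $I=(i_1<\dots<i_p)$ and $J=(j_1<\dots<j_p)$ the quantum row and column minors are $$[I,J]_r=\sum_{\sigma\in S_p}(-q)^{-l(\sigma)}a_{i_1j_{\sigma(1)}}\cdots a_{i_pj_{\sigma(p)}},\qquad [I,J]_c=\sum_{\sigma\in S_p}(-q)^{-l(\sigma)}a_{i_{\sigma(1)}j_1}\cdots a_{i_{\sigma(p)}j_p},$$ where $l$ is the number of inversions. For arbitrary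 sequences $Z,W$ of $p$ distinct indices put $[Z,W]=(-q)^{-l(Z)-l(W)}[Z_{ord},W_{ord}]$, where $Z_{ord}$ is the increasing rearrangement of $Z$ (for row as well as for column minors). **Towers.** Let $I\subseteq\{1,\dots,n\}$ be a set of $r$ indices $i_1<\dots<i_r$, and put $i_0=0$. As long as $I\ne(1\dots r)$, let $p$ be the first position with $i_p-i_{p-1}>1$, and let $\sigma_I=(i_p-1,\,i_p)$. Replacing $I$ by $\sigma_I I$ repeatedly gives the standard row tower $I=I_N>I_{N-1}>\dots>I_0=(1\dots r)$, with $\sigma^r_t=\sigma_{I_t}$ and $I_{t-1}=\sigma^r_tI_t$. Similarly, let $J$ be a set of $r$ indices $j_1<\dots<j_r$, and put $j_{r+1}=n+1$. As long as $J\neq(n-r+1\dots n)$, let $p$ be the last position with $j_{p+1}-j_p>1$, and use the transposition $(j_p,\,j_p+1)$. This gives the standard column tower $J=J_M<\dots<J_0=(n-r+1\dots n)$, with transpositions $\sigma^c_1,\dots,\sigma^c_M$, $J_{u-1}=\sigma^c_uJ_u$. **Index families.** Each $C_i^{I_t,J_u}$ is a finite family, with repetitions allowed, of pairs $(Z,W)$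 of sequences, each carried along with complementary sequences $Z',W'$ and a sign; it is empty if $i<0$. A row (column) transposition acts on the entries of $Z$ and $Z'$ (of $W$ and $W'$). Put $C_0^{I_0,J_0}=((I_0,J_0))$, with increasing complements, and $C_i^{I_0,J_0}=\emptyset$ for $i\ne0$. For $1\le u\le M$, $$C_i^{I_0,J_u}=\bigl(C_{i-1}^{I_0,J_{u-1}}-\phi_{i-1}^{I_0,J_{u-1}},\ \sigma^c_u(C_i^{I_0,J_{u-1}})\bigr),$$ where, with $\sigma^c_u=(m,m+1)$, $\phi_{i-1}^{I_0,J_{u-1}}$ consists of the members of $C_{i-1}^{I_0,J_{u-1}}$ for which $m$ occurs before $m+1$ in the concatenated sequence $(W,W')$. For $1\le t\le N$, $$C_i^{I_t,J_M}=\bigl(C_{i-1}^{I_{t-1},J_M}-\psi_{i-1}^{I_{t-1},J_M},\ \sigma^r_t(C_i^{I_{t-1},J_M})\bigr),$$ where, with $\sigma^r_t=(m,m+1)$, $\psi_{i-1}^{I_{t-1},J_M}$ consists of the members of $C_{i-1}^{I_{t-1},J_M}$ for which $m+1$ occurs before $m$ in $(Z,Z')$. Members of $C_i^{I_0,J_M}$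 have sign $(-1)^i$. In the second recursion each member keeps the sign of the member from which it comes. Put $C_i^{I,J}=C_i^{I_N,J_M}$. **Theorem.** Let $I,J\subseteq\{1,\dots,n\}$ with $|I|=|J|=r$, and let $I',J'$ be their complements in $\{1,\dots,n\}$ (all taken in increasing order). Then $$[I',J'][I,J]\equiv\sum_{i=0}^{M+N}(q^{-1}-q)^i\sum_{(Z,W)\in C_i^{I,J}}\mathrm{sign}(Z,W)\,[Z,W]\,[Z',W'].$$ This holds with all minors read as row minors, and also with all minors read as column minors. -/

import Mathlib

open scoped LaurentPolynomial

namespace QuantumMinors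

section Algebra

/-- The free algebra `k_q⟨a_{rs}⟩` over `k_q = k[q, q⁻¹]` on generators `a_{rs}`,
`r, s` in an index set of `n` elements. -/
abbrev FreeAlg (k : Type*) [Field k] (n : ℕ) : Type _ :=
  FreeAlgebra k[T;T⁻¹] (Fin n × Fin n)

variable (k : Type*) [Field k] {n : ℕ}

/-- The indeterminate `q`. -/
noncomputable def q : k[T;T⁻¹] := LaurentPolynomial.T 1

/-- The inverse `q⁻¹` of the indeterminate `q`. -/
noncomputable def qInv : k[T;T⁻¹] := LaurentPolynomial.T (-1)

/-- The generator `a_{ij}` of the free algebra. -/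
noncomputable def gen (i j : Fin n) : FreeAlg k n := FreeAlgebra.ι k[T;T⁻¹] (i, j)

/-- The Manin relations: `ManinRel k x y` says that `x = y` is one of them. -/
inductive ManinRel : FreeAlg k n → FreeAlg k n → Prop
  | row (i j l : Fin n) (h : j < l) :
      ManinRel (gen k i j * gen k i l) (qInv k • (gen k i l * gen k i j))
  | col (i j l : Fin n) (h : j < l) :
      ManinRel (gen k j i * gen k l i) (qInv k • (gen k l i * gen k j i))
  | comm (i j m l : Fin n) (h : (i < m ∧ l < j) ∨ (m < i ∧ j < l)) :
      ManinRel (gen k i j * gen k m l) (gen k m l * gen k i j)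
  | cross (i j m l : Fin n) (h : i < m ∧ j < l) :
      ManinRel (gen k i j * gen k m l - gen k m l * gen k i j)
        ((qInv k - q k) • (gen k m j * gen k i l))

/-- The two-sided ideal of the Manin relations. -/
noncomputable def maninIdeal (n : ℕ) : TwoSidedIdeal (FreeAlg k n) :=
  TwoSidedIdeal.span {z | ∃ x y, ManinRel k x y ∧ z = x - y}

/-- Congruence modulo the Manin ideal. -/
def Congr (x y : FreeAlg k n) : Prop := x - y ∈ maninIdeal k n

/-- The number of inversions of a finite sequence.  For a permutation this is its length, and for
a sequence of distinct elements it is the length of the permutation that sorts it. -/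
def inversions {p : ℕ} {α : Type*} [LinearOrder α] (x : Fin p → α) : ℕ :=
  (Finset.univ.filter fun ab : Fin p × Fin p => ab.1 < ab.2 ∧ x ab.2 < x ab.1).card

/-- The row minor `∑_σ (-q)^{-l(σ)} a_{i_1 j_{σ 1}} ⋯ a_{i_p j_{σ p}}`
of increasing multi-indices `i`, `j`. -/
noncomputable def orderedRowMinor {p : ℕ} (i j : Fin p → Fin n) : FreeAlg k n :=
  ∑ σ : Equiv.Perm (Fin p),
    (-qInv k) ^ inversions σ • (List.ofFn fun a => gen k (i a) (j (σ a))).prod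

/-- The column minor `∑_σ (-q)^{-l(σ)} a_{i_{σ 1} j_1} ⋯ a_{i_{σ p} j_p}`
of increasing multi-indices `i`, `j`. -/
noncomputable def orderedColMinor {p : ℕ} (i j : Fin p → Fin n) : FreeAlg k n :=
  ∑ σ : Equiv.Perm (Fin p),
    (-qInv k) ^ inversions σ • (List.ofFn fun a => gen k (i (σ a)) (j a)).prod

/-- The increasing rearrangement of a multi-index. -/
def ordered {p : ℕ} (x : Fin p → Fin n) : Fin p → Fin n := x ∘ Tuple.sort x

/-- The row minor of multi-indices `z`, `w` of distinct elements, not necessarily increasing: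
`[z, w] = (-q)^{-l(z)-l(w)} [z_ord, w_ord]`. -/
noncomputable def rowMinor {p : ℕ} (z w : Fin p → Fin n) : FreeAlg k n :=
  (-qInv k) ^ (inversions z + inversions w) • orderedRowMinor k (ordered z) (ordered w)

/-- The column minor of multi-indices `z`, `w` of distinct elements, not necessarily increasing:
`[z, w] = (-q)^{-l(z)-l(w)} [z_ord, w_ord]`. -/
noncomputable def colMinor {p : ℕ} (z w : Fin p → Fin n) : FreeAlg k n :=
  (-qInv k) ^ (inversions z + inversions w) • orderedColMinor k (ordered z) (ordered w)

end Algebra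

section Towers

variable {n : ℕ}

/-- The entries `i_p` of `I = (i_1 < ⋯ < i_r)` with `i_p - i_{p-1} > 1`, where `i_0` is one less
than the smallest index; that is, the elements of `I` whose predecessor exists and is not
in `I`. -/
def rowGaps (I : Finset (Fin n)) : Finset (Fin n) :=
  I.filter fun i => ∃ m : Fin n, m.val + 1 = i.val ∧ m ∉ I

/-- The entries `j_p` of `J = (j_1 < ⋯ < j_r)` with `j_{p+1} - j_p > 1`, where `j_{r+1}` is one more
than the largest index; that is, the elements of `J` whose successor exists and is not
in `J`. -/
def colGaps (J : Finset (Fin n)) : Finset (Fin n) :=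
  J.filter fun j => ∃ m : Fin n, j.val + 1 = m.val ∧ m ∉ J

/-- For `I` with a gap, the standard row transposition `σ_I = (i_p - 1, i_p)`, with `i_p` the first
entry that has a gap before it, as the pair `(i_p - 1, i_p)`. -/
def rowTransposition (I : Finset (Fin n)) (h : (rowGaps I).Nonempty) : Fin n × Fin n :=
  (⟨((rowGaps I).min' h).val - 1, by omega⟩, (rowGaps I).min' h)

theorem exists_succ_colGap (J : Finset (Fin n)) (h : (colGaps J).Nonempty) :
    ((colGaps J).max' h).val + 1 < n := by
  have h1 := (colGaps J).max'_mem h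
  simp only [colGaps, Finset.mem_filter] at h1
  obtain ⟨-, m, hm, -⟩ := h1
  have := m.isLt
  simp only [colGaps]
  omega

/-- For `J` with a gap, the standard column transposition `σ_J = (j_p, j_p + 1)`, with `j_p` the
last entry that has a gap after it, as the pair `(j_p, j_p + 1)`. -/
def colTransposition (J : Finset (Fin n)) (h : (colGaps J).Nonempty) : Fin n × Fin n :=
  ((colGaps J).max' h, ⟨((colGaps J).max' h).val + 1, exists_succ_colGap J h⟩)

/-- The transposition exchanging the two entries of a pair. -/
abbrev transp (σ : Fin n × Fin n) : Equiv.Perm (Fin n) := Equiv.swap σ.1 σ.2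

theorem rowTower_decreasing (I : Finset (Fin n)) (h : (rowGaps I).Nonempty) :
    ∑ i ∈ I.map (transp (rowTransposition I h)).toEmbedding, i.val < ∑ i ∈ I, i.val := by
  have h1 := (rowGaps I).min'_mem h
  set i := (rowGaps I).min' h with hi
  have h2 := h1
  simp only [rowGaps, Finset.mem_filter] at h2
  obtain ⟨hiI, m, hm, hmI⟩ := h2
  have ht : rowTransposition I h = (m, i) := by
    ext
    · simp only [rowTransposition, ← hi]; omega
    · simp only [rowTransposition, ← hi]
  rw [ht, Finset.sum_map]
  refine Finset.sum_lt_sum (fun x hx => ?_) ⟨i, hiI, ?_⟩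
  · have hxm : x ≠ m := fun e => hmI (e ▸ hx)
    by_cases hxi : x = i
    · subst hxi; simp [transp]; omega
    · simp [transp, Equiv.swap_apply_of_ne_of_ne hxm hxi]
  · simp [transp]; omega

theorem colTower_decreasing (J : Finset (Fin n)) (h : (colGaps J).Nonempty) :
    ∑ j ∈ J.map (transp (colTransposition J h)).toEmbedding, (n - j.val) <
      ∑ j ∈ J, (n - j.val) := by
  have h1 := (colGaps J).max'_mem h
  set i := (colGaps J).max' h with hi
  have h2 := h1
  simp only [colGaps, Finset.mem_filter] at h2
  obtain ⟨hiI, m, hm, hmI⟩ := h2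
  have hml := m.isLt
  have ht : colTransposition J h = (i, m) := by
    ext
    · simp only [colTransposition, ← hi]
    · simp only [colTransposition, ← hi]; omega
  rw [ht, Finset.sum_map]
  refine Finset.sum_lt_sum (fun x hx => ?_) ⟨i, hiI, ?_⟩
  · have hxm : x ≠ m := fun e => hmI (e ▸ hx)
    by_cases hxi : x = i
    · subst hxi; simp [transp]; omega
    · simp [transp, Equiv.swap_apply_of_ne_of_ne hxi hxm]
  · simp [transp]; omega

/-- The transpositions `[σ_N, …, σ_1]` of the standard row tower
`I = I_N > I_{N-1} > ⋯ > I_0`, where `σ_t I_t = I_{t-1}` and `σ_t` is the standard row transposition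
of `I_t`. -/
def rowTower (I : Finset (Fin n)) : List (Fin n × Fin n) :=
  if h : (rowGaps I).Nonempty then
    rowTransposition I h :: rowTower (I.map (transp (rowTransposition I h)).toEmbedding)
  else []
termination_by ∑ i ∈ I, i.val
decreasing_by exact rowTower_decreasing I h

/-- The transpositions `[σ_M, …, σ_1]` of the standard column tower
`J = J_M < J_{M-1} < ⋯ < J_0`, where `σ_s J_s = J_{s-1}` and `σ_s` is the standard column
transposition of `J_s`. -/
def colTower (J : Finset (Fin n)) : List (Fin n × Fin n) :=
  if h : (colGaps J).Nonempty then
    colTransposition J h :: colTower (J.map (transp (colTransposition J h)).toEmbedding)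
  else []
termination_by ∑ j ∈ J, (n - j.val)
decreasing_by exact colTower_decreasing J h

/-- The row intertwining order: the length of the standard row tower. -/
def intr (I : Finset (Fin n)) : ℕ := (rowTower I).length

/-- The column intertwining order: the length of the standard column tower. -/
def intc (J : Finset (Fin n)) : ℕ := (colTower J).length

end Towers

section IndexSets

variable {n r s : ℕ}

/-- `x` occurs before `y` in the sequence `(u, u') = (u_1 … u_r u'_1 … u'_s)`. -/
def Before (u : Fin r → Fin n) (u' : Fin s → Fin n) (x y : Fin n) : Prop :=
  ∃ a b : Fin (r + s), a < b ∧ Fin.append u u' a = x ∧ Fin.append u u' b = y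

instance (u : Fin r → Fin n) (u' : Fin s → Fin n) (x y : Fin n) :
    Decidable (Before u u' x y) :=
  inferInstanceAs (Decidable (∃ a b : Fin (r + s),
    a < b ∧ Fin.append u u' a = x ∧ Fin.append u u' b = y))

/-- `I_0 = (1 … r)`. -/
def rowBase (hn : r + s = n) : Fin r → Fin n := fun a => ⟨a.val, by omega⟩

/-- `I_0' = (r+1 … n)`. -/
def rowBaseCompl (hn : r + s = n) : Fin s → Fin n := fun a => ⟨r + a.val, by omega⟩

/-- `J_0 = (n-r+1 … n)`. -/
def colBase (hn : r + s = n) : Fin r → Fin n := fun a => ⟨s + a.val, by omega⟩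

/-- `J_0' = (1 … n-r)`. -/
def colBaseCompl (hn : r + s = n) : Fin s → Fin n := fun a => ⟨a.val, by omega⟩

/-- A column index together with its complement, both as sequences. -/
structure ColPair (n r s : ℕ) where
  W : Fin r → Fin n
  W' : Fin s → Fin n

/-- A row index `Z` and a column index `W` with their complements, all as sequences, and the sign
attached to this member of an index family. -/
structure SignedIndex (n r s : ℕ) where
  sign : ℤ
  Z : Fin r → Fin n
  Z' : Fin s → Fin n
  W : Fin r → Fin n
  W' : Fin s → Fin n

/-- The column action of a permutation. -/
def ColPair.act (σ : Equiv.Perm (Fin n)) (c : ColPair n r s) : ColPair n r s :=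
  ⟨σ ∘ c.W, σ ∘ c.W'⟩

/-- The row action of a permutation; it keeps the sign. -/
def SignedIndex.rowAct (σ : Equiv.Perm (Fin n)) (e : SignedIndex n r s) : SignedIndex n r s :=
  ⟨e.sign, σ ∘ e.Z, σ ∘ e.Z', e.W, e.W'⟩

/-- `colFamily hn [σ_s, …, σ_1] i` is the family `C_i^{I_0,J_s}`: it starts from `((J_0, J_0'))` in
degree `0`, and
`C_i^{I_0,J_s} = (C_{i-1}^{I_0,J_{s-1}} - φ_{i-1}^{I_0,J_{s-1}}, σ_s (C_i^{I_0,J_{s-1}}))`,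
where, for `σ_s = (m, m+1)`, `φ` consists of the members `(W, W')` in which `m` occurs before `m+1`.
A list is used because members may be repeated. -/
def colFamily (hn : r + s = n) : List (Fin n × Fin n) → ℕ → List (ColPair n r s)
  | [], 0 => [⟨colBase hn, colBaseCompl hn⟩]
  | [], _ + 1 => []
  | σ :: τ, 0 => (colFamily hn τ 0).map (ColPair.act (transp σ))
  | σ :: τ, i + 1 =>
      (colFamily hn τ i).filter (fun c => ¬ Before c.W c.W' σ.1 σ.2) ++
        (colFamily hn τ (i + 1)).map (ColPair.act (transp σ))

/-- `rowFamily hn cols [σ_t, …, σ_1] i` is the family `C_i^{I_t,J_M}` with its signs, where `cols`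
is the list of the transpositions of the column tower of `J`: it starts from `C_i^{I_0,J_M}` with
signs `(-1)^i`, and
`C_i^{I_t,J_M} = (C_{i-1}^{I_{t-1},J_M} - ψ_{i-1}^{I_{t-1},J_M}, σ_t (C_i^{I_{t-1},J_M}))`,
where, for `σ_t = (m, m+1)`, `ψ` consists of the members in which `m+1` occurs before `m` in
`(Z, Z')`. -/
def rowFamily (hn : r + s = n) (cols : List (Fin n × Fin n)) :
    List (Fin n × Fin n) → ℕ → List (SignedIndex n r s)
  | [], i => (colFamily hn cols i).map fun c =>
      ⟨(-1) ^ i, rowBase hn, rowBaseCompl hn, c.W, c.W'⟩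
  | σ :: τ, 0 => (rowFamily hn cols τ 0).map (SignedIndex.rowAct (transp σ))
  | σ :: τ, i + 1 =>
      (rowFamily hn cols τ i).filter (fun e => ¬ Before e.Z e.Z' σ.2 σ.1) ++
        (rowFamily hn cols τ (i + 1)).map (SignedIndex.rowAct (transp σ))

/-- The family `C_i^{I,J}` with its signs. -/
def indexFamily (hn : r + s = n) (I J : Finset (Fin n)) (i : ℕ) : List (SignedIndex n r s) :=
  rowFamily hn (colTower J) (rowTower I) i

/-- The increasing sequence of the elements of `I`. -/
def seq {p : ℕ} (I : Finset (Fin n)) (h : I.card = p) : Fin p → Fin n := I.orderEmbOfFin h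

theorem card_compl_eq (hn : r + s = n) {I : Finset (Fin n)} (h : I.card = r) :
    Iᶜ.card = s := by
  rw [Finset.card_compl, Fintype.card_fin]; omega

end IndexSets

end QuantumMinors

/-!
Work in the quotient of the free algebra by the Manin relations.  For neighbouring columns `m` and
`m' = m + 1` consider the words in which each of the two columns occurs exactly once.  On them there
is a linear operator `hecke` which exchanges the two columns and, if `m'` occurs before `m`,
subtracts `q⁻¹ - q` times the word; it satisfies the quadratic relation of a Hecke algebra.

The operator descends to the quotient (`toManin_hecke_eq`): it depends on a word only through the
relative position of the columns `m` and `m'`.  A relation that does not involve both of them is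
therefore carried to a relation, and the relations between the columns `m` and `m'` are permuted by
a direct computation.

On a product `[Z, W] [Z', W']` of complementary minors the operator acts in one of two ways
(`IsHeckeMinor.toManin_hecke_mul`).  If `m` and `m'` occur in different factors, all words of the
product have them in the same order, and the formula for words carries over verbatim.  If they occur
in the same factor, that minor is an eigenvector for the eigenvalue `-q⁻¹`
(`toManin_hecke_orderedRowMinor`, `toManin_hecke_orderedColMinor`), and since an exchange of
neighbours in a sequence changes the minor by a power of `-q⁻¹`, the outcome is again the exchange
of `m` and `m'`, minus `q⁻¹ - q` times the product if `m'` precedes `m`.  This is exactly the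
recursion that defines the index families.

For `I₀ = (1 … r)` and `J₀ = (n-r+1 … n)` the generators in the two minors commute.  Applying the
operators along the column tower to both sides of this commutation relation gives the expansion for
`I₀` and `J`: on the left `m` always precedes `m'`, so that no correction term arises.
Transposition of matrices exchanges row and column minors and preserves the ideal of relations, so
it turns the operator for columns into one for rows; its inverse `heckeRow`, applied along the row
tower, gives the general case.
-/

namespace QuantumMinors

/-! ### The Manin algebra and words -/

section ManinQuotient

variable (k : Type*) [Field k] {n : ℕ}

/-- The quotient map from the free algebra onto the Manin algebra of quantum matrices. -/
noncomputable def toManin (n : ℕ) :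
    FreeAlg k n →ₐ[k[T;T⁻¹]] (maninIdeal k n).ringCon.Quotient :=
  RingCon.mkₐ _ (maninIdeal k n).ringCon

theorem congr_iff_toManin_eq {x y : FreeAlg k n} :
    Congr k x y ↔ toManin k n x = toManin k n y := by
  rw [Congr, ← TwoSidedIdeal.rel_iff]
  exact (RingCon.eq (maninIdeal k n).ringCon).symm

theorem toManin_eq_of_maninRel {x y : FreeAlg k n} (h : ManinRel k x y) :
    toManin k n x = toManin k n y :=
  (congr_iff_toManin_eq k).1 (TwoSidedIdeal.subset_span ⟨x, y, h, rfl⟩)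

theorem qInv_mul_q : qInv k * q k = 1 := by
  rw [qInv, q, ← LaurentPolynomial.T_add]; simp

/-- The product `a_{i₁ j₁} ⋯ a_{i_p j_p}` attached to a list of pairs `(i, j)`. -/
noncomputable def word (w : List (Fin n × Fin n)) : FreeAlg k n :=
  (w.map fun p => gen k p.1 p.2).prod

@[simp] theorem word_nil : word k ([] : List (Fin n × Fin n)) = 1 := rfl

@[simp] theorem word_cons (p : Fin n × Fin n) (w : List (Fin n × Fin n)) :
    word k (p :: w) = gen k p.1 p.2 * word k w := by simp [word]

@[simp] theorem word_append (v w : List (Fin n × Fin n)) :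
    word k (v ++ w) = word k v * word k w := by simp [word]

theorem basisFreeMonoid_eq_word (w : List (Fin n × Fin n)) :
    FreeAlgebra.basisFreeMonoid k[T;T⁻¹] (Fin n × Fin n) (FreeMonoid.ofList w) = word k w := by
  induction w with
  | nil =>
    simp [FreeAlgebra.basisFreeMonoid, FreeAlgebra.equivMonoidAlgebraFreeMonoid]
  | cons p w ih =>
    rw [word_cons, ← ih]
    simp [FreeAlgebra.basisFreeMonoid, FreeAlgebra.equivMonoidAlgebraFreeMonoid, gen]

theorem span_range_word : Submodule.span k[T;T⁻¹] (Set.range (word k (n := n))) = ⊤ := by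
  rw [← (FreeAlgebra.basisFreeMonoid k[T;T⁻¹] (Fin n × Fin n)).span_eq]
  congr 1
  ext x
  constructor
  · rintro ⟨w, rfl⟩
    exact ⟨_, basisFreeMonoid_eq_word k w⟩
  · rintro ⟨w, rfl⟩
    exact ⟨w.toList, (basisFreeMonoid_eq_word k w.toList).symm⟩

/-- A linear map that sends every relation, placed between two words, to a congruence descends to
the Manin algebra. -/
theorem toManin_map_eq_of_maninRel (f : FreeAlg k n →ₗ[k[T;T⁻¹]] FreeAlg k n)
    (hf : ∀ (u v : List (Fin n × Fin n)) (x y : FreeAlg k n), ManinRel k x y →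
      toManin k n (f (word k u * x * word k v)) = toManin k n (f (word k u * y * word k v)))
    {x y : FreeAlg k n} (h : toManin k n x = toManin k n y) :
    toManin k n (f x) = toManin k n (f y) := by
  have hz : x - y ∈ maninIdeal k n := (congr_iff_toManin_eq k).2 h
  rw [← sub_eq_zero, ← map_sub, ← map_sub]
  generalize x - y = z at hz
  rw [maninIdeal, TwoSidedIdeal.mem_span_iff_mem_addSubgroup_closure] at hz
  induction hz using AddSubgroup.closure_induction with
  | mem z hz =>
    obtain ⟨_, ⟨a, -, _, ⟨x, y, hxy, rfl⟩, rfl⟩, b, -, rfl⟩ := hz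
    simp only
    have ha : a ∈ Submodule.span k[T;T⁻¹] (Set.range (word k (n := n))) := by
      rw [span_range_word]; trivial
    have hb : b ∈ Submodule.span k[T;T⁻¹] (Set.range (word k (n := n))) := by
      rw [span_range_word]; trivial
    induction ha, hb using Submodule.span_induction₂ with
    | mem_mem u v hu hv =>
      obtain ⟨u, rfl⟩ := hu
      obtain ⟨v, rfl⟩ := hv
      rw [mul_sub, sub_mul, map_sub, map_sub, hf u v x y hxy, sub_self]
    | zero_left => simp
    | zero_right => simp
    | add_left a a' b _ _ _ h1 h2 => rw [add_mul, add_mul, map_add, map_add, h1, h2, add_zero]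
    | add_right a b b' _ _ _ h1 h2 => rw [mul_add, map_add, map_add, h1, h2, add_zero]
    | smul_left c a b _ _ h1 =>
      rw [smul_mul_assoc, smul_mul_assoc, map_smul, map_smul, h1, smul_zero]
    | smul_right c a b _ _ h1 => rw [mul_smul_comm, map_smul, map_smul, h1, smul_zero]
  | zero => simp
  | add x y _ _ hx hy => rw [map_add, map_add, hx, hy, add_zero]
  | neg x _ hx => rw [map_neg, map_neg, hx, neg_zero]

end ManinQuotient

/-! ### Transposition of quantum matrices -/

section Transposition

variable (k : Type*) [Field k] {n : ℕ}

/-- The transposition automorphism `a_{ij} ↦ a_{ji}` of the free algebra. -/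
noncomputable def transpose (n : ℕ) : FreeAlg k n →ₐ[k[T;T⁻¹]] FreeAlg k n :=
  FreeAlgebra.lift _ fun p => gen k p.2 p.1

@[simp] theorem transpose_gen (i j : Fin n) : transpose k n (gen k i j) = gen k j i := by
  simp [transpose, gen]

@[simp] theorem transpose_transpose (x : FreeAlg k n) : transpose k n (transpose k n x) = x := by
  have : (transpose k n).comp (transpose k n) = AlgHom.id _ _ := by
    ext ⟨i, j⟩
    exact (congrArg (transpose k n) (transpose_gen k i j)).trans (transpose_gen k j i)
  exact DFunLike.congr_fun this x

/-- The transposes of the Manin relations follow from the Manin relations. -/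
theorem toManin_transpose_eq {x y : FreeAlg k n} (h : toManin k n x = toManin k n y) :
    toManin k n (transpose k n x) = toManin k n (transpose k n y) := by
  refine toManin_map_eq_of_maninRel k (transpose k n).toLinearMap (fun u v x y hxy => ?_) h
  suffices H : toManin k n (transpose k n x) = toManin k n (transpose k n y) by
    simp only [AlgHom.toLinearMap_apply, map_mul, H]
  cases hxy with
  | row i j l h => simpa using toManin_eq_of_maninRel k (.col i j l h)
  | col i j l h => simpa using toManin_eq_of_maninRel k (.row i j l h)
  | comm i j m l h =>
    simpa using toManin_eq_of_maninRel k (.comm j i l m (by tauto))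
  | cross i j m l h =>
    -- The transposed relation has the factors on the right in the other order; they commute.
    have h1 := toManin_eq_of_maninRel k (.cross j i l m h.symm)
    have h2 := toManin_eq_of_maninRel k (.comm l i j m (.inr h.symm))
    simp only [map_sub, map_mul, map_smul, transpose_gen] at h1 h2 ⊢
    rw [h1, h2]

theorem transpose_rowMinor {p : ℕ} (z w : Fin p → Fin n) :
    transpose k n (rowMinor k z w) = colMinor k w z := by
  simp [rowMinor, colMinor, orderedRowMinor, orderedColMinor, map_list_prod, List.map_ofFn,
    Function.comp_def, add_comm]

theorem transpose_colMinor {p : ℕ} (z w : Fin p → Fin n) :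
    transpose k n (colMinor k z w) = rowMinor k w z := by
  rw [← transpose_rowMinor, transpose_transpose]

end Transposition

/-! ### The Hecke operator of two neighbouring columns -/

section Hecke

variable (k : Type*) [Field k] {n : ℕ} (m m' : Fin n)

/-- A transposition of neighbours preserves the order of every other pair. -/
theorem swap_lt_swap (hm : m.val + 1 = m'.val) {x y : Fin n} (h : x < y)
    (hxy : ¬ (x = m ∧ y = m')) : Equiv.swap m m' x < Equiv.swap m m' y := by
  rw [Equiv.swap_apply_def, Equiv.swap_apply_def]
  split_ifs <;> simp only [Fin.lt_def, Fin.ext_iff] at * <;> omega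

/-- The subsequence of a sequence of columns that consists of its entries `m` and `m'`. -/
def trace (c : List (Fin n)) : List (Fin n) := c.filter fun x => x = m ∨ x = m'

@[simp] theorem trace_append (c d : List (Fin n)) :
    trace m m' (c ++ d) = trace m m' c ++ trace m m' d := by simp [trace]

/-- The endomorphism that exchanges the columns `m` and `m'` of the generators. -/
noncomputable def colSwap : FreeAlg k n →ₐ[k[T;T⁻¹]] FreeAlg k n :=
  FreeAlgebra.lift _ fun p => gen k p.1 (Equiv.swap m m' p.2)

@[simp] theorem colSwap_gen (i j : Fin n) :
    colSwap k m m' (gen k i j) = gen k i (Equiv.swap m m' j) := by simp [colSwap, gen]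

/-- The weight of the swapped word in the Hecke operator, for a word with trace `L`.  It vanishes
unless each of `m` and `m'` occurs exactly once. -/
noncomputable def swapWeight (L : List (Fin n)) : k[T;T⁻¹] :=
  if L = [m, m'] ∨ L = [m', m] then 1 else 0

/-- The weight of the word itself in the Hecke operator, for a word with trace `L`. -/
noncomputable def idWeight (L : List (Fin n)) : k[T;T⁻¹] :=
  if L = [m', m] then -(qInv k - q k) else 0

/-- The Hecke operator on the words in which each of the columns `m` and `m'` occurs exactly once:
it exchanges the two columns and, if `m'` occurs before `m`, subtracts `q⁻¹ - q` times the word.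
All other words are sent to `0`. -/
noncomputable def hecke : FreeAlg k n →ₗ[k[T;T⁻¹]] FreeAlg k n :=
  (FreeAlgebra.basisFreeMonoid k[T;T⁻¹] (Fin n × Fin n)).constr k[T;T⁻¹] fun w =>
    swapWeight k m m' (trace m m' (w.toList.map Prod.snd)) • colSwap k m m' (word k w.toList) +
      idWeight k m m' (trace m m' (w.toList.map Prod.snd)) • word k w.toList

theorem hecke_word (w : List (Fin n × Fin n)) :
    hecke k m m' (word k w) =
      swapWeight k m m' (trace m m' (w.map Prod.snd)) • colSwap k m m' (word k w) +
        idWeight k m m' (trace m m' (w.map Prod.snd)) • word k w := by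
  rw [← basisFreeMonoid_eq_word, hecke, Module.Basis.constr_basis, basisFreeMonoid_eq_word]
  rfl

/-- The span of the words whose columns have trace `L`. -/
noncomputable def traceSpan (L : List (Fin n)) : Submodule k[T;T⁻¹] (FreeAlg k n) :=
  Submodule.span _ (word k '' {w | trace m m' (w.map Prod.snd) = L})

variable {k m m'}

theorem word_mem_traceSpan (w : List (Fin n × Fin n)) :
    word k w ∈ traceSpan k m m' (trace m m' (w.map Prod.snd)) :=
  Submodule.subset_span ⟨w, rfl, rfl⟩

theorem mul_mem_traceSpan {L L' : List (Fin n)} {x y : FreeAlg k n}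
    (hx : x ∈ traceSpan k m m' L) (hy : y ∈ traceSpan k m m' L') :
    x * y ∈ traceSpan k m m' (L ++ L') := by
  have h := Submodule.mul_mem_mul hx hy
  rw [traceSpan, traceSpan, Submodule.span_mul_span] at h
  refine Submodule.span_mono ?_ h
  rintro _ ⟨_, ⟨v, rfl, rfl⟩, _, ⟨w, rfl, rfl⟩, rfl⟩
  exact ⟨v ++ w, by simp, by simp⟩

theorem hecke_of_mem {L : List (Fin n)} {x : FreeAlg k n} (hx : x ∈ traceSpan k m m' L) :
    hecke k m m' x = swapWeight k m m' L • colSwap k m m' x + idWeight k m m' L • x := by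
  induction hx using Submodule.span_induction with
  | mem x h => obtain ⟨w, rfl, rfl⟩ := h; exact hecke_word k m m' w
  | zero => simp
  | add x y _ _ hx hy => rw [map_add, map_add, hx, hy, smul_add, smul_add]; abel
  | smul c x _ hx =>
    rw [map_smul, map_smul, hx, smul_add, smul_comm c, smul_comm c]

theorem colSwap_of_mem {x : FreeAlg k n} (hx : x ∈ traceSpan k m m' []) :
    colSwap k m m' x = x := by
  induction hx using Submodule.span_induction with
  | mem x h =>
    obtain ⟨w, hw, rfl⟩ := h
    simp only [trace, Set.mem_ofPred_eq, List.filter_eq_nil_iff, List.mem_map, decide_eq_true_eq,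
      not_or, forall_exists_index, and_imp, forall_apply_eq_imp_iff₂] at hw
    rw [word, map_list_prod, List.map_map]
    congr 1
    refine List.map_congr_left fun p hp => ?_
    obtain ⟨h1, h2⟩ := hw p hp
    simp [Equiv.swap_apply_of_ne_of_ne h1 h2]
  | zero => simp
  | add x y _ _ hx hy => rw [map_add, hx, hy]
  | smul c x _ hx => rw [map_smul, hx]

theorem induction_word {P : FreeAlg k n → Prop} (hw : ∀ w, P (word k w))
    (h0 : P 0) (ha : ∀ x y, P x → P y → P (x + y)) (hs : ∀ (c : k[T;T⁻¹]) x, P x → P (c • x))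
    (x : FreeAlg k n) : P x := by
  have hx : x ∈ Submodule.span k[T;T⁻¹] (Set.range (word k (n := n))) := by
    rw [span_range_word]; trivial
  induction hx using Submodule.span_induction with
  | mem x h => obtain ⟨w, rfl⟩ := h; exact hw w
  | zero => exact h0
  | add x y _ _ hx hy => exact ha x y hx hy
  | smul c x _ hx => exact hs c x hx

theorem hecke_mul_right (x : FreeAlg k n) {y : FreeAlg k n} (hy : y ∈ traceSpan k m m' []) :
    hecke k m m' (x * y) = hecke k m m' x * y := by
  induction x using induction_word with
  | hw w =>
    have hw := word_mem_traceSpan (k := k) (m := m) (m' := m') w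
    have h := mul_mem_traceSpan hw hy
    rw [List.append_nil] at h
    rw [hecke_of_mem h, hecke_of_mem hw, map_mul, colSwap_of_mem hy, add_mul, smul_mul_assoc,
      smul_mul_assoc]
  | h0 => simp
  | ha x x' h h' => rw [add_mul, map_add, map_add, h, h', add_mul]
  | hs c x h => rw [smul_mul_assoc, map_smul, map_smul, h, smul_mul_assoc]

theorem hecke_mul_left {x : FreeAlg k n} (hx : x ∈ traceSpan k m m' []) (y : FreeAlg k n) :
    hecke k m m' (x * y) = x * hecke k m m' y := by
  induction y using induction_word with
  | hw w =>
    have hw := word_mem_traceSpan (k := k) (m := m) (m' := m') w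
    have h := mul_mem_traceSpan hx hw
    rw [List.nil_append] at h
    rw [hecke_of_mem h, hecke_of_mem hw, map_mul, colSwap_of_mem hx, mul_add, mul_smul_comm,
      mul_smul_comm]
  | h0 => simp
  | ha x x' h h' => rw [mul_add, map_add, map_add, h, h', mul_add]
  | hs c x h => rw [mul_smul_comm, map_smul, map_smul, h, mul_smul_comm]

theorem gen_mul_gen_eq_word (i j s l : Fin n) :
    gen k i j * gen k s l = word k [(i, j), (s, l)] := by simp

theorem gen_mul_gen_mem (i j s l : Fin n) :
    gen k i j * gen k s l ∈ traceSpan k m m' (trace m m' [j, l]) := by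
  rw [gen_mul_gen_eq_word]
  exact word_mem_traceSpan [(i, j), (s, l)]

theorem trace_pair_comm {j l : Fin n} (h : j < l) (hjl : ¬ (j = m ∧ l = m'))
    (hm : m.val + 1 = m'.val) : trace m m' [l, j] = trace m m' [j, l] := by
  have h' : ¬ ((j = m ∨ j = m') ∧ (l = m ∨ l = m')) := by
    simp only [Fin.lt_def, Fin.ext_iff] at *; omega
  by_cases h1 : j = m ∨ j = m' <;> by_cases h2 : l = m ∨ l = m'
  · exact absurd ⟨h1, h2⟩ h'
  all_goals simp [trace, h1, h2]

theorem hecke_mul_word_mul {L : List (Fin n)} (u v : List (Fin n × Fin n)) {x : FreeAlg k n}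
    (hx : x ∈ traceSpan k m m' L) :
    hecke k m m' (word k u * x * word k v) =
      swapWeight k m m' (trace m m' (u.map Prod.snd) ++ L ++ trace m m' (v.map Prod.snd)) •
          colSwap k m m' (word k u * x * word k v) +
        idWeight k m m' (trace m m' (u.map Prod.snd) ++ L ++ trace m m' (v.map Prod.snd)) •
          (word k u * x * word k v) :=
  hecke_of_mem (mul_mem_traceSpan (mul_mem_traceSpan (word_mem_traceSpan u) hx)
    (word_mem_traceSpan v))

/-- The Hecke operator is compatible with a relation that is homogeneous for the trace and whose
image under the exchange of the columns `m` and `m'` is again a relation. -/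
theorem toManin_hecke_of_homogeneous {L : List (Fin n)} (u v : List (Fin n × Fin n))
    {x y : FreeAlg k n} (hx : x ∈ traceSpan k m m' L) (hy : y ∈ traceSpan k m m' L)
    (hxy : toManin k n x = toManin k n y)
    (hs : toManin k n (colSwap k m m' x) = toManin k n (colSwap k m m' y)) :
    toManin k n (hecke k m m' (word k u * x * word k v)) =
      toManin k n (hecke k m m' (word k u * y * word k v)) := by
  rw [hecke_mul_word_mul u v hx, hecke_mul_word_mul u v hy]
  simp only [map_add, map_smul, map_mul, hxy, hs]

/-- Between words that avoid the columns `m` and `m'` the Hecke operator acts on a combination of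
words with trace `[m, m']` or `[m', m]`; between other words it annihilates it. -/
theorem toManin_hecke_of_pair (u v : List (Fin n × Fin n)) {x y : FreeAlg k n}
    (hx : x ∈ traceSpan k m m' [m, m'] ⊔ traceSpan k m m' [m', m])
    (hy : y ∈ traceSpan k m m' [m, m'] ⊔ traceSpan k m m' [m', m])
    (hxy : toManin k n (hecke k m m' x) = toManin k n (hecke k m m' y)) :
    toManin k n (hecke k m m' (word k u * x * word k v)) =
      toManin k n (hecke k m m' (word k u * y * word k v)) := by
  by_cases huv : trace m m' (u.map Prod.snd) = [] ∧ trace m m' (v.map Prod.snd) = []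
  · have hu := word_mem_traceSpan (k := k) (m := m) (m' := m') u
    have hv := word_mem_traceSpan (k := k) (m := m) (m' := m') v
    rw [huv.1] at hu
    rw [huv.2] at hv
    simp only [hecke_mul_right _ hv, hecke_mul_left hu, map_mul, hxy]
  · have key : ∀ L : List (Fin n), L.length = 2 → ∀ x ∈ traceSpan k m m' L,
        hecke k m m' (word k u * x * word k v) = 0 := by
      intro L hL x hx
      -- The trace of the whole word has more than two entries.
      rw [hecke_mul_word_mul u v hx]
      have hlen : ∀ a b,
          trace m m' (u.map Prod.snd) ++ L ++ trace m m' (v.map Prod.snd) ≠ [a, b] := by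
        intro a b e
        have := congrArg List.length e
        simp only [List.length_append, hL, List.length_cons, List.length_nil] at this
        exact huv ⟨List.length_eq_zero_iff.1 (by omega), List.length_eq_zero_iff.1 (by omega)⟩
      simp [swapWeight, idWeight, -List.append_assoc, hlen]
    have key' : ∀ x ∈ traceSpan k m m' [m, m'] ⊔ traceSpan k m m' [m', m],
        hecke k m m' (word k u * x * word k v) = 0 := by
      intro x hx
      obtain ⟨a, ha, b, hb, rfl⟩ := Submodule.mem_sup.1 hx
      rw [mul_add, add_mul, map_add, key _ rfl a ha, key _ rfl b hb, add_zero]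
    rw [key' x hx, key' y hy]

theorem hecke_of_mem_before {x : FreeAlg k n} (hx : x ∈ traceSpan k m m' [m, m'])
    (hne : m ≠ m') : hecke k m m' x = colSwap k m m' x := by
  simp [hecke_of_mem hx, swapWeight, idWeight, hne]

theorem hecke_of_mem_after {x : FreeAlg k n} (hx : x ∈ traceSpan k m m' [m', m]) :
    hecke k m m' x = colSwap k m m' x - (qInv k - q k) • x := by
  rw [hecke_of_mem hx, swapWeight, idWeight, if_pos (.inr rfl), if_pos rfl, one_smul]
  have h : (-(qInv k - q k)) • x = -((qInv k - q k) • x) := neg_smul (qInv k - q k) x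
  rw [h]
  exact (sub_eq_add_neg _ _).symm

theorem toManin_hecke_eq (hm : m.val + 1 = m'.val) {x y : FreeAlg k n}
    (h : toManin k n x = toManin k n y) :
    toManin k n (hecke k m m' x) = toManin k n (hecke k m m' y) := by
  have hne : m ≠ m' := fun e => by rw [e] at hm; omega
  have mem1 : ∀ i s, gen k i m * gen k s m' ∈ traceSpan k m m' [m, m'] := fun i s => by
    simpa [trace] using gen_mul_gen_mem (k := k) (m := m) (m' := m') i m s m'
  have mem2 : ∀ i s, gen k i m' * gen k s m ∈ traceSpan k m m' [m', m] := fun i s => by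
    simpa [trace] using gen_mul_gen_mem (k := k) (m := m) (m' := m') i m' s m
  have hqq := qInv_mul_q k
  refine toManin_map_eq_of_maninRel k _ (fun u v x y hxy => ?_) h
  cases hxy with
  | row i j l h =>
    by_cases hjl : j = m ∧ l = m'
    · obtain ⟨rfl, rfl⟩ := hjl
      -- Both sides become `a_{im'} a_{im}`: `q⁻¹ (q⁻¹ - (q⁻¹ - q)) = 1`.
      refine toManin_hecke_of_pair u v (Submodule.mem_sup_left (mem1 _ _))
        (Submodule.mem_sup_right (Submodule.smul_mem _ _ (mem2 _ _))) ?_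
      rw [hecke_of_mem_before (mem1 _ _) hne, map_smul, hecke_of_mem_after (mem2 _ _)]
      have e := toManin_eq_of_maninRel k (.row i j l h)
      simp only [map_mul, map_sub, map_smul, colSwap_gen, Equiv.swap_apply_left,
        Equiv.swap_apply_right] at e ⊢
      rw [e, ← sub_smul, smul_smul]
      have : qInv k * (qInv k - (qInv k - q k)) = 1 := by rw [← hqq]; ring
      rw [this, one_smul]
    · have hL := trace_pair_comm h hjl hm
      refine toManin_hecke_of_homogeneous u v (gen_mul_gen_mem i j i l)
        (hL ▸ Submodule.smul_mem _ _ (gen_mul_gen_mem i l i j))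
        (toManin_eq_of_maninRel k (.row i j l h)) ?_
      simpa using toManin_eq_of_maninRel k (.row i _ _ (swap_lt_swap m m' hm h hjl))
  | col i j l h =>
    refine toManin_hecke_of_homogeneous u v (gen_mul_gen_mem j i l i)
      (Submodule.smul_mem _ _ (gen_mul_gen_mem l i j i))
      (toManin_eq_of_maninRel k (.col i j l h)) ?_
    simpa using toManin_eq_of_maninRel k (.col (Equiv.swap m m' i) j l h)
  | comm i j s l h =>
    have main : ∀ i j s l : Fin n, i < s → l < j →
        toManin k n (hecke k m m' (word k u * (gen k i j * gen k s l) * word k v)) =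
          toManin k n (hecke k m m' (word k u * (gen k s l * gen k i j) * word k v)) := by
      intro i j s l h1 h2
      by_cases hjl : l = m ∧ j = m'
      · obtain ⟨rfl, rfl⟩ := hjl
        -- The image of the commutation relation is the relation `cross`.
        refine toManin_hecke_of_pair u v (Submodule.mem_sup_right (mem2 _ _))
          (Submodule.mem_sup_left (mem1 _ _)) ?_
        rw [hecke_of_mem_before (mem1 _ _) hne, hecke_of_mem_after (mem2 _ _)]
        have e := toManin_eq_of_maninRel k (.cross i l s j ⟨h1, h2⟩)
        have e' := toManin_eq_of_maninRel k (.comm i j s l (.inl ⟨h1, h2⟩))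
        simp only [map_mul, map_sub, map_smul, colSwap_gen, Equiv.swap_apply_left,
          Equiv.swap_apply_right] at e e' ⊢
        rw [e', ← e]; abel
      · have hL := trace_pair_comm h2 hjl hm
        refine toManin_hecke_of_homogeneous u v (gen_mul_gen_mem i j s l)
          (hL ▸ gen_mul_gen_mem s l i j)
          (toManin_eq_of_maninRel k (.comm i j s l (.inl ⟨h1, h2⟩))) ?_
        simpa using toManin_eq_of_maninRel k
          (.comm i _ s _ (.inl ⟨h1, swap_lt_swap m m' hm h2 hjl⟩))
    rcases h with ⟨h1, h2⟩ | ⟨h1, h2⟩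
    · exact main i j s l h1 h2
    · exact (main s l i j h1 h2).symm
  | cross i j s l h =>
    obtain ⟨h1, h2⟩ := h
    by_cases hjl : j = m ∧ l = m'
    · obtain ⟨rfl, rfl⟩ := hjl
      -- The image of the relation `cross` is the commutation relation: the corrections cancel.
      refine toManin_hecke_of_pair u v
        (Submodule.sub_mem _ (Submodule.mem_sup_left (mem1 _ _))
          (Submodule.mem_sup_right (mem2 _ _)))
        (Submodule.smul_mem _ _ (Submodule.mem_sup_left (mem1 _ _))) ?_
      rw [map_sub, map_smul, hecke_of_mem_before (mem1 _ _) hne,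
        hecke_of_mem_before (mem1 _ _) hne, hecke_of_mem_after (mem2 _ _)]
      have e := toManin_eq_of_maninRel k (.comm i l s j (.inl ⟨h1, h2⟩))
      simp only [map_mul, map_sub, map_smul, colSwap_gen, Equiv.swap_apply_left,
        Equiv.swap_apply_right] at e ⊢
      rw [e]; abel
    · have hL := trace_pair_comm h2 hjl hm
      refine toManin_hecke_of_homogeneous u v
        (Submodule.sub_mem _ (gen_mul_gen_mem i j s l) (hL ▸ gen_mul_gen_mem s l i j))
        (Submodule.smul_mem _ _ (gen_mul_gen_mem s j i l))
        (toManin_eq_of_maninRel k (.cross i j s l ⟨h1, h2⟩)) ?_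
      simpa using toManin_eq_of_maninRel k
        (.cross i _ s _ ⟨h1, swap_lt_swap m m' hm h2 hjl⟩)

end Hecke

/-! ### Inversions under an exchange of neighbours -/

section Inversions

variable {n p : ℕ} {m m' : Fin n}

theorem inversions_inv (σ : Equiv.Perm (Fin p)) :
    inversions (σ⁻¹ : Equiv.Perm (Fin p)) = inversions σ := by
  refine Finset.card_bij (fun ab _ => (σ⁻¹ ab.2, σ⁻¹ ab.1)) ?_ ?_ ?_
  · simp only [Finset.mem_filter, Finset.mem_univ, true_and]
    rintro ⟨a, b⟩ ⟨h1, h2⟩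
    simpa using ⟨h2, h1⟩
  · rintro ⟨a, b⟩ _ ⟨c, d⟩ _ h
    simpa [and_comm] using h
  · simp only [Finset.mem_filter, Finset.mem_univ, true_and]
    rintro ⟨a, b⟩ ⟨h1, h2⟩
    exact ⟨(σ b, σ a), by simpa using ⟨h2, h1⟩, by simp⟩

theorem swap_comp_lt_iff (hm : m.val + 1 = m'.val) {x : Fin p → Fin n}
    (hx : ¬ (m ∈ Set.range x ∧ m' ∈ Set.range x)) (a b : Fin p) :
    Equiv.swap m m' (x a) < Equiv.swap m m' (x b) ↔ x a < x b := by
  have key : ∀ a b, x a < x b → Equiv.swap m m' (x a) < Equiv.swap m m' (x b) :=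
    fun a b h => swap_lt_swap m m' hm h fun e => hx ⟨⟨a, e.1⟩, ⟨b, e.2⟩⟩
  refine ⟨fun h => ?_, key a b⟩
  rcases lt_trichotomy (x a) (x b) with h' | h' | h'
  · exact h'
  · rw [h'] at h; exact absurd h (lt_irrefl _)
  · exact absurd (key b a h') h.not_gt

theorem inversions_swap_comp_of_not_both (hm : m.val + 1 = m'.val) {x : Fin p → Fin n}
    (hx : ¬ (m ∈ Set.range x ∧ m' ∈ Set.range x)) :
    inversions (Equiv.swap m m' ∘ x) = inversions x := by
  simp only [inversions, Function.comp_apply, swap_comp_lt_iff hm hx]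

/-- Exchanging two neighbouring values that occur in their natural order creates exactly one
inversion. -/
theorem inversions_swap_comp (hm : m.val + 1 = m'.val) {x : Fin p → Fin n}
    (hx : Function.Injective x) {a b : Fin p} (ha : x a = m) (hb : x b = m') (hab : a < b) :
    inversions (Equiv.swap m m' ∘ x) = inversions x + 1 := by
  have hlt : m < m' := by rw [Fin.lt_def]; omega
  have hmem : (a, b) ∉ Finset.univ.filter
      fun ab : Fin p × Fin p => ab.1 < ab.2 ∧ x ab.2 < x ab.1 := by
    simp [ha, hb, hlt.le]
  rw [inversions, inversions, ← Finset.card_insert_of_notMem hmem]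
  -- The new inversion is the pair of positions `(a, b)`; every other pair keeps its order.
  congr 1
  ext ⟨c, d⟩
  simp only [Finset.mem_filter, Finset.mem_univ, true_and, Finset.mem_insert, Prod.mk.injEq,
    Function.comp_apply]
  by_cases hcd : (c, d) = (a, b)
  · obtain ⟨rfl, rfl⟩ := Prod.mk.inj hcd
    simp [ha, hb, hab, hlt]
  · have hcd' : ¬ (c = a ∧ d = b) := fun e => hcd (Prod.ext e.1 e.2)
    simp only [hcd', false_or, and_congr_right_iff]
    intro h
    rcases lt_or_gt_of_ne (hx.ne h.ne) with h' | h'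
    · have := swap_lt_swap m m' hm h' fun e =>
        hcd' ⟨hx (e.1.trans ha.symm), hx (e.2.trans hb.symm)⟩
      simp only [this.not_gt, h'.not_gt]
    · have := swap_lt_swap m m' hm h' fun e => by
        have h1 := hx (e.1.trans ha.symm)
        have h2 := hx (e.2.trans hb.symm)
        subst h1 h2
        exact absurd h hab.not_gt
      simp only [this, h']

/-- Composition with `(a b)` on the right exchanges the neighbouring values `a` and `b` of the
inverse permutation. -/
theorem inversions_mul_swap {a b : Fin p} (hab : a.val + 1 = b.val) (σ : Equiv.Perm (Fin p))
    (h : σ a < σ b) : inversions (σ * Equiv.swap a b) = inversions σ + 1 := by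
  have := inversions_swap_comp hab (x := (σ⁻¹ : Equiv.Perm (Fin p))) (σ⁻¹).injective
    (a := σ a) (b := σ b) (by simp) (by simp) h
  rw [inversions_inv] at this
  rw [← this, ← inversions_inv]
  rw [mul_inv_rev, Equiv.swap_inv]
  rfl

end Inversions

/-! ### Increasing rearrangements -/

section Ordered

variable {n p : ℕ} {m m' : Fin n}

theorem ordered_strictMono {x : Fin p → Fin n} (hx : Function.Injective x) :
    StrictMono (ordered x) :=
  (Tuple.monotone_sort x).strictMono_of_injective (hx.comp (Tuple.sort x).injective)

theorem ordered_eq_of_perm {x : Fin p → Fin n} (τ : Equiv.Perm (Fin p)) (h : Monotone (x ∘ τ)) :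
    ordered x = x ∘ τ :=
  Tuple.unique_monotone (Tuple.monotone_sort x) h

theorem range_ordered (x : Fin p → Fin n) : Set.range (ordered x) = Set.range x := by
  rw [ordered, EquivLike.range_comp]

theorem ordered_swap_comp_of_not_both (hm : m.val + 1 = m'.val) {x : Fin p → Fin n}
    (hi : Function.Injective x) (hx : ¬ (m ∈ Set.range x ∧ m' ∈ Set.range x)) :
    ordered (Equiv.swap m m' ∘ x) = Equiv.swap m m' ∘ ordered x := by
  refine ordered_eq_of_perm (Tuple.sort x) (StrictMono.monotone fun a b hab => ?_)
  exact (swap_comp_lt_iff hm hx _ _).2 (ordered_strictMono hi hab)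

theorem ordered_swap_comp {x : Fin p → Fin n} (hi : Function.Injective x) {a b : Fin p}
    (ha : x a = m) (hb : x b = m') : ordered (Equiv.swap m m' ∘ x) = ordered x := by
  subst ha hb
  rw [hi.swap_comp]
  have : ordered x = (x ∘ Equiv.swap a b) ∘ (Equiv.swap a b * Tuple.sort x : Equiv.Perm _) := by
    ext c; simp [ordered]
  rw [this]
  exact ordered_eq_of_perm _ (this ▸ Tuple.monotone_sort x)

end Ordered

/-! ### Traces of sequences of distinct columns -/

section Trace

variable {n p : ℕ} {m m' : Fin n}

theorem trace_ofFn_nil {x : Fin p → Fin n} (h : m ∉ Set.range x) (h' : m' ∉ Set.range x) :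
    trace m m' (List.ofFn x) = [] := by
  simp only [trace, List.filter_eq_nil_iff, List.mem_ofFn', decide_eq_true_eq]
  rintro _ hc (rfl | rfl)
  exacts [h hc, h' hc]

theorem trace_comm (c : List (Fin n)) : trace m m' c = trace m' m c := by
  simp only [trace, or_comm]

theorem trace_ofFn_singleton {x : Fin p → Fin n} (hx : Function.Injective x)
    (h : m ∈ Set.range x) (h' : m' ∉ Set.range x) : trace m m' (List.ofFn x) = [m] := by
  have h1 : trace m m' (List.ofFn x) = (List.ofFn x).filter (· = m) := by
    refine List.filter_congr fun c hc => ?_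
    have : c ≠ m' := by rintro rfl; exact h' ((List.mem_ofFn' _ _).1 hc)
    simp [this]
  rw [h1, List.filter_eq, List.count_eq_one_of_mem (List.nodup_ofFn.2 hx) ((List.mem_ofFn' _ _).2 h)]
  rfl

theorem trace_ofFn_pair {x : Fin p → Fin n} (hx : Function.Injective x) {a b : Fin p}
    (ha : x a = m) (hb : x b = m') (hab : a < b) : trace m m' (List.ofFn x) = [m, m'] := by
  have hne : m ≠ m' := by rw [← ha, ← hb]; exact hx.ne hab.ne
  have hnd : (trace m m' (List.ofFn x)).Nodup := (List.nodup_ofFn.2 hx).filter _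
  have hpw : (trace m m' (List.ofFn x)).Pairwise fun c d => ¬ (c = m' ∧ d = m) := by
    refine List.Pairwise.filter _ (List.pairwise_ofFn.2 ?_)
    rintro c d hcd ⟨h1, h2⟩
    rw [hx (h1.trans hb.symm), hx (h2.trans ha.symm)] at hcd
    exact hab.not_gt hcd
  have hperm : (trace m m' (List.ofFn x)).Perm [m, m'] := by
    refine (List.perm_ext_iff_of_nodup hnd (by simpa using hne)).2 fun c => ?_
    simp only [trace, List.mem_filter, List.mem_ofFn', decide_eq_true_eq, List.mem_cons,
      List.not_mem_nil, or_false, and_iff_right_iff_imp]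
    rintro (rfl | rfl)
    exacts [⟨a, ha⟩, ⟨b, hb⟩]
  generalize trace m m' (List.ofFn x) = L at *
  obtain ⟨c, d, rfl⟩ := List.length_eq_two.1 hperm.length_eq
  have h1 : c = m ∨ c = m' := by simpa using hperm.mem_iff (a := c)
  have h2 : d = m ∨ d = m' := by simpa using hperm.mem_iff (a := d)
  have h3 : c ≠ d := by simpa using hnd
  have h4 : ¬ (c = m' ∧ d = m) := by simpa using hpw
  rcases h1 with rfl | rfl <;> rcases h2 with rfl | rfl <;> simp_all

end Trace

/-! ### Minors as eigenvectors of the Hecke operator -/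

section Minors

variable (k : Type*) [Field k] {n p : ℕ} {m m' : Fin n}

theorem orderedRowMinor_eq_sum_word (i j : Fin p → Fin n) :
    orderedRowMinor k i j = ∑ σ : Equiv.Perm (Fin p),
      (-qInv k) ^ inversions σ • word k (List.ofFn fun a => (i a, j (σ a))) := by
  simp [orderedRowMinor, word, List.map_ofFn, Function.comp_def]

theorem orderedColMinor_eq_sum_word (i j : Fin p → Fin n) :
    orderedColMinor k i j = ∑ σ : Equiv.Perm (Fin p),
      (-qInv k) ^ inversions σ • word k (List.ofFn fun a => (i (σ a), j a)) := by
  simp [orderedColMinor, word, List.map_ofFn, Function.comp_def]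

theorem colSwap_word_ofFn (f : Fin p → Fin n × Fin n) :
    colSwap k m m' (word k (List.ofFn f)) =
      word k (List.ofFn fun a => ((f a).1, Equiv.swap m m' (f a).2)) := by
  simp [word, map_list_prod, List.map_ofFn, Function.comp_def]

theorem colSwap_orderedRowMinor (i j : Fin p → Fin n) :
    colSwap k m m' (orderedRowMinor k i j) = orderedRowMinor k i (Equiv.swap m m' ∘ j) := by
  simp [orderedRowMinor_eq_sum_word, colSwap_word_ofFn]

theorem colSwap_orderedColMinor (i j : Fin p → Fin n) :
    colSwap k m m' (orderedColMinor k i j) = orderedColMinor k i (Equiv.swap m m' ∘ j) := by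
  simp [orderedColMinor_eq_sum_word, colSwap_word_ofFn]

theorem word_ofFn_mem_traceSpan {L : List (Fin n)} (f : Fin p → Fin n × Fin n)
    (h : trace m m' (List.ofFn fun a => (f a).2) = L) :
    word k (List.ofFn f) ∈ traceSpan k m m' L := by
  have := word_mem_traceSpan (k := k) (m := m) (m' := m') (List.ofFn f)
  rwa [List.map_ofFn, show Prod.snd ∘ f = fun a => (f a).2 from rfl, h] at this

theorem orderedRowMinor_mem_traceSpan {L : List (Fin n)} (i j : Fin p → Fin n)
    (h : ∀ σ : Equiv.Perm (Fin p), trace m m' (List.ofFn (j ∘ σ)) = L) :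
    orderedRowMinor k i j ∈ traceSpan k m m' L := by
  rw [orderedRowMinor_eq_sum_word]
  exact Submodule.sum_mem _ fun σ _ => Submodule.smul_mem _ _ (word_ofFn_mem_traceSpan k _ (h σ))

theorem orderedColMinor_mem_traceSpan {L : List (Fin n)} (i j : Fin p → Fin n)
    (h : trace m m' (List.ofFn j) = L) :
    orderedColMinor k i j ∈ traceSpan k m m' L := by
  rw [orderedColMinor_eq_sum_word]
  exact Submodule.sum_mem _ fun σ _ => Submodule.smul_mem _ _ (word_ofFn_mem_traceSpan k _ h)

/-- A sum over all permutations vanishes if the summands cancel in pairs `σ`, `g σ`, where `g` is a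
fixed point free involution; it suffices to check the cancellation for one member of each pair,
singled out by the property `P`. -/
theorem sum_perm_eq_zero {A : Type*} [AddCommGroup A] (f : Equiv.Perm (Fin p) → A)
    (g : Equiv.Perm (Fin p) → Equiv.Perm (Fin p)) (P : Equiv.Perm (Fin p) → Prop)
    (hg : ∀ σ, g (g σ) = σ) (hne : ∀ σ, g σ ≠ σ) (hP : ∀ σ, P σ ∨ P (g σ))
    (hf : ∀ σ, P σ → f σ + f (g σ) = 0) : ∑ σ, f σ = 0 := by
  refine Finset.sum_involution (fun σ _ => g σ) (fun σ _ => ?_) (fun σ _ _ => hne σ)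
    (fun _ _ => Finset.mem_univ _) (fun σ _ => hg σ)
  rcases hP σ with h | h
  · exact hf σ h
  · rw [add_comm]
    simpa [hg] using hf (g σ) h

/-- In an increasing sequence the neighbouring values `m` and `m'` stand in neighbouring places. -/
theorem val_succ_eq_of_strictMono (hm : m.val + 1 = m'.val) {j : Fin p → Fin n}
    (hj : StrictMono j) {a b : Fin p} (ha : j a = m) (hb : j b = m') : a.val + 1 = b.val := by
  have hab : a < b := hj.lt_iff_lt.1 (by rw [ha, hb, Fin.lt_def]; omega)
  by_contra hne
  have h1 : a < ⟨a.val + 1, by omega⟩ := Fin.lt_def.2 (by simp)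
  have h2 : (⟨a.val + 1, by omega⟩ : Fin p) < b := by
    rw [Fin.lt_def] at hab ⊢; simp only; omega
  have h3 := hj h1
  have h4 := hj h2
  rw [ha] at h3
  rw [hb] at h4
  rw [Fin.lt_def] at h3 h4
  omega

theorem smul_combination_eq_zero {R A : Type*} [CommRing R] [AddCommGroup A] [Module R A]
    (c d h : R) (e : 1 + d * (h - d) = 0) (w w' : A) :
    c • w' + d • c • w + ((c * -d) • (w - h • w') + d • (c * -d) • w') = 0 := by
  have : c • w' + d • c • w + ((c * -d) • (w - h • w') + d • (c * -d) • w') =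
      (c * (1 + d * (h - d))) • w' := by
    module
  rw [this, e, mul_zero, zero_smul]

/-- A row minor whose columns include `m` and `m'` is an eigenvector of the Hecke operator: the
words for `σ` and `(a b) σ` span a plane that the operator preserves. -/
theorem toManin_hecke_orderedRowMinor (hm : m.val + 1 = m'.val) (i : Fin p → Fin n)
    {j : Fin p → Fin n} (hj : StrictMono j) {a b : Fin p} (ha : j a = m) (hb : j b = m') :
    toManin k n (hecke k m m' (orderedRowMinor k i j) + qInv k • orderedRowMinor k i j) = 0 := by
  have hab := val_succ_eq_of_strictMono hm hj ha hb
  have hne : a ≠ b := fun e => by rw [e] at hab; omega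
  have hmne : m ≠ m' := fun e => by rw [e] at hm; omega
  have hqq := qInv_mul_q k
  rw [orderedRowMinor_eq_sum_word, map_sum, Finset.smul_sum, ← Finset.sum_add_distrib, map_sum]
  refine sum_perm_eq_zero _ (fun σ => Equiv.swap a b * σ) (fun σ => σ⁻¹ a < σ⁻¹ b)
    (fun σ => by simp [← mul_assoc]) (fun σ h => hne ?_) (fun σ => ?_) (fun σ hσ => ?_)
  · have h' : Equiv.swap a b = 1 := mul_eq_right.1 h
    simpa using (DFunLike.congr_fun h' b)
  · have : σ⁻¹ a ≠ σ⁻¹ b := (σ⁻¹).injective.ne hne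
    rcases lt_or_gt_of_ne this with h | h
    · exact .inl h
    · right; simpa [mul_inv_rev] using h
  · have hinv : inversions (Equiv.swap a b * σ : Equiv.Perm (Fin p)) = inversions σ + 1 :=
      inversions_swap_comp hab σ.injective (a := σ⁻¹ a) (b := σ⁻¹ b) (by simp) (by simp) hσ
    have hswap : ∀ c, Equiv.swap m m' (j c) = j (Equiv.swap a b c) := fun c => by
      rw [← ha, ← hb]; exact congrFun (hj.injective.swap_comp a b) c
    set w := word k (List.ofFn fun c => (i c, j (σ c))) with hw
    set w' := word k (List.ofFn fun c => (i c, j ((Equiv.swap a b * σ) c))) with hw'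
    have e1 : colSwap k m m' w = w' := by
      simp [hw, hw', colSwap_word_ofFn, hswap]
    have e2 : colSwap k m m' w' = w := by
      simp [hw, hw', colSwap_word_ofFn, hswap]
    have m1 : w ∈ traceSpan k m m' [m, m'] :=
      word_ofFn_mem_traceSpan k _ (trace_ofFn_pair (hj.injective.comp σ.injective)
        (a := σ⁻¹ a) (b := σ⁻¹ b) (by simpa) (by simpa) hσ)
    have m2 : w' ∈ traceSpan k m m' [m', m] :=
      word_ofFn_mem_traceSpan k _ ((trace_comm _).trans
        (trace_ofFn_pair (hj.injective.comp (Equiv.swap a b * σ).injective)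
          (a := σ⁻¹ a) (b := σ⁻¹ b) (by simpa) (by simpa) hσ))
    rw [map_smul, map_smul, hecke_of_mem_before m1 hmne, hecke_of_mem_after m2, e1, e2, hinv]
    simp only [map_add, map_sub, map_smul, pow_succ]
    refine smul_combination_eq_zero ((-qInv k) ^ inversions σ) (qInv k) (qInv k - q k) ?_
      (toManin k n w) (toManin k n w')
    rw [← hqq]; ring

/-- Words that differ only in the neighbouring positions `a` and `b` have a common beginning and a
common end. -/
theorem exists_ofFn_eq_append {α : Type*} {a b : Fin p} (hab : a.val + 1 = b.val) (f : Fin p → α) :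
    ∃ u v : List α, ∀ g : Fin p → α, (∀ c, c ≠ a → c ≠ b → g c = f c) →
      List.ofFn g = u ++ ([g a, g b] ++ v) := by
  refine ⟨(List.ofFn f).take a, (List.ofFn f).drop (b + 1), fun g hg => ?_⟩
  refine List.ext_getElem (by simp; omega) fun c h1 h2 => ?_
  simp only [List.length_ofFn] at h1
  have ha : ((List.ofFn f).take a).length = a := by simp
  rw [List.getElem_ofFn]
  rcases lt_trichotomy c a.val with h | h | h
  · rw [List.getElem_append_left (by simpa [ha] using h), List.getElem_take, List.getElem_ofFn]
    exact hg _ (fun e => by simp [← e] at h) (fun e => by rw [← e] at hab; simp at hab; omega)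
  · subst h
    rw [List.getElem_append_right (by simp)]
    simp
  · rw [List.getElem_append_right (by simp; omega)]
    by_cases hc : c = b.val
    · subst hc
      have : b.val - a.val = 1 := by omega
      simp [this]
    · rw [List.getElem_append_right (by simp; omega), List.getElem_drop, List.getElem_ofFn]
      have : b.val + 1 + (c - ((List.ofFn f).take a).length - [g a, g b].length) = c := by
        simp; omega
      simp only [this]
      exact hg _ (fun e => by simp [← e] at h) (fun e => by simp [← e] at hc)

/-- The two-row computation behind the eigenvector property of column minors. -/
theorem toManin_pair_eq_zero (hm : m.val + 1 = m'.val) {s t : Fin n} (hst : s < t) :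
    toManin k n (gen k s m' * gen k t m + qInv k • (gen k s m * gen k t m')) =
      toManin k n (qInv k • (gen k t m' * gen k s m + qInv k • (gen k t m * gen k s m'))) := by
  have hlt : m < m' := by rw [Fin.lt_def]; omega
  have e1 := toManin_eq_of_maninRel k (.comm s m' t m (.inl ⟨hst, hlt⟩))
  have e2 := toManin_eq_of_maninRel k (.cross s m t m' ⟨hst, hlt⟩)
  have hqq := qInv_mul_q k
  rw [map_sub, sub_eq_iff_eq_add] at e2
  rw [map_add, map_smul, map_smul, map_add, map_smul, e1, e2, map_smul]
  generalize toManin k n (gen k t m * gen k s m') = x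
  generalize toManin k n (gen k t m' * gen k s m) = y
  have : x + qInv k • ((qInv k - q k) • x + y) =
      (1 - qInv k * q k) • x + qInv k • (y + qInv k • x) := by module
  rw [this, hqq, sub_self, zero_smul, zero_add]

/-- A column minor whose columns include `m` and `m'` is, in the Manin algebra, an eigenvector of
the Hecke operator: the words for `σ` and `σ (a b)` cancel by the relations between two rows. -/
theorem toManin_hecke_orderedColMinor (hm : m.val + 1 = m'.val) {i : Fin p → Fin n}
    (hi : StrictMono i) {j : Fin p → Fin n}
    (hj : StrictMono j) {a b : Fin p} (ha : j a = m) (hb : j b = m') :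
    toManin k n (hecke k m m' (orderedColMinor k i j) + qInv k • orderedColMinor k i j) = 0 := by
  have hab := val_succ_eq_of_strictMono hm hj ha hb
  have hlt : a < b := by rw [Fin.lt_def]; omega
  have hmne : m ≠ m' := fun e => by rw [e] at hm; omega
  rw [hecke_of_mem_before (orderedColMinor_mem_traceSpan k i j
    (trace_ofFn_pair hj.injective ha hb hlt)) hmne, colSwap_orderedColMinor,
    orderedColMinor_eq_sum_word, orderedColMinor_eq_sum_word, Finset.smul_sum,
    ← Finset.sum_add_distrib, map_sum]
  refine sum_perm_eq_zero _ (fun σ => σ * Equiv.swap a b) (fun σ => σ a < σ b)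
    (fun σ => by simp [mul_assoc]) (fun σ h => hlt.ne ?_) (fun σ => ?_) (fun σ hσ => ?_)
  · have h' : Equiv.swap a b = 1 := mul_eq_left.1 h
    simpa using (DFunLike.congr_fun h' b)
  · rcases lt_or_gt_of_ne (σ.injective.ne hlt.ne) with h | h
    · exact .inl h
    · right; simpa using h
  · rw [inversions_mul_swap hab σ hσ]
    -- The words for `σ` and `σ (a b)` differ only in the places `a` and `b`, which leaves the
    -- relation between four products of two generators.
    obtain ⟨u, v, huv⟩ := exists_ofFn_eq_append hab fun c => (i (σ c), j c)
    have hw : ∀ g : Fin p → Fin n × Fin n, (∀ c, c ≠ a → c ≠ b → g c = (i (σ c), j c)) →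
        word k (List.ofFn g) =
          word k u * (gen k (g a).1 (g a).2 * gen k (g b).1 (g b).2) * word k v := by
      intro g hg
      rw [huv g hg]
      simp [mul_assoc]
    have hj' : ∀ c, c ≠ a → c ≠ b → Equiv.swap m m' (j c) = j c := fun c h1 h2 =>
      Equiv.swap_apply_of_ne_of_ne (fun e => h1 (hj.injective (e.trans ha.symm)))
        (fun e => h2 (hj.injective (e.trans hb.symm)))
    rw [hw (fun c => (i (σ c), (Equiv.swap m m' ∘ j) c))
        (fun c h1 h2 => by simp [hj' c h1 h2]),
      hw (fun c => (i (σ c), j c)) (fun c h1 h2 => rfl),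
      hw (fun c => (i ((σ * Equiv.swap a b) c), (Equiv.swap m m' ∘ j) c))
        (fun c h1 h2 => by simp [hj' c h1 h2, Equiv.swap_apply_of_ne_of_ne h1 h2]),
      hw (fun c => (i ((σ * Equiv.swap a b) c), j c))
        (fun c h1 h2 => by simp [Equiv.swap_apply_of_ne_of_ne h1 h2])]
    have key := toManin_pair_eq_zero k hm (hi hσ)
    simp only [Function.comp_apply, ha, hb, Equiv.swap_apply_left, Equiv.swap_apply_right,
      Equiv.Perm.mul_apply]
    simp only [map_add, map_smul, map_mul, pow_succ] at key ⊢
    generalize toManin k n (word k u) = U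
    generalize toManin k n (word k v) = V
    have key' := congrArg (fun x => U * x * V) key
    simp only [mul_add, add_mul, mul_smul_comm, smul_mul_assoc, smul_add] at key' ⊢
    rw [← sub_eq_zero] at key'
    have := congrArg (fun x => (-qInv k) ^ inversions σ • x) key'
    simp only [smul_zero] at this
    rw [← this]
    module

end Minors

/-! ### The Hecke operator on a product of two minors -/

section Step

variable (k : Type*) [Field k] {n : ℕ}

/-- What the Hecke operator of the columns `m` and `m'` sees of a kind of minors `μ`; both the row
minors and the column minors have these properties. -/
structure IsHeckeMinor (m m' : Fin n)
    (μ : (p : ℕ) → (Fin p → Fin n) → (Fin p → Fin n) → FreeAlg k n) : Prop where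
  colSwap_eq : ∀ {p : ℕ} (z : Fin p → Fin n) {w : Fin p → Fin n}, Function.Injective w →
    ¬ (m ∈ Set.range w ∧ m' ∈ Set.range w) →
    colSwap k m m' (μ p z w) = μ p z (Equiv.swap m m' ∘ w)
  mem_nil : ∀ {p : ℕ} (z : Fin p → Fin n) {w : Fin p → Fin n},
    m ∉ Set.range w → m' ∉ Set.range w → μ p z w ∈ traceSpan k m m' []
  mem_left : ∀ {p : ℕ} (z : Fin p → Fin n) {w : Fin p → Fin n}, Function.Injective w →
    m ∈ Set.range w → m' ∉ Set.range w → μ p z w ∈ traceSpan k m m' [m]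
  mem_right : ∀ {p : ℕ} (z : Fin p → Fin n) {w : Fin p → Fin n}, Function.Injective w →
    m' ∈ Set.range w → m ∉ Set.range w → μ p z w ∈ traceSpan k m m' [m']
  hecke_eq : ∀ {p : ℕ} {z w : Fin p → Fin n}, Function.Injective z → Function.Injective w →
    m ∈ Set.range w → m' ∈ Set.range w →
    toManin k n (hecke k m m' (μ p z w)) = -qInv k • toManin k n (μ p z w)
  swap_eq : ∀ {p : ℕ} (z : Fin p → Fin n) {w : Fin p → Fin n}, Function.Injective w →
    ∀ {a b : Fin p}, w a = m → w b = m' → a < b →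
    μ p z (Equiv.swap m m' ∘ w) = -qInv k • μ p z w

variable {m m' : Fin n}

theorem toManin_hecke_smul_eq {c : k[T;T⁻¹]} {x : FreeAlg k n}
    (h : toManin k n (hecke k m m' x + qInv k • x) = 0) :
    toManin k n (hecke k m m' (c • x)) = -qInv k • toManin k n (c • x) := by
  rw [map_add, map_smul (toManin k n)] at h
  rw [map_smul, map_smul, map_smul, eq_neg_of_add_eq_zero_left h, smul_comm, neg_smul]

theorem isHeckeMinor_rowMinor (hm : m.val + 1 = m'.val) :
    IsHeckeMinor k m m' fun _ => rowMinor k where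
  colSwap_eq z w hi hw := by
    rw [rowMinor, rowMinor, map_smul, colSwap_orderedRowMinor,
      inversions_swap_comp_of_not_both hm hw, ordered_swap_comp_of_not_both hm hi hw]
  mem_nil z w h h' := by
    refine Submodule.smul_mem _ _ (orderedRowMinor_mem_traceSpan k _ _ fun σ => ?_)
    refine trace_ofFn_nil ?_ ?_ <;> rwa [EquivLike.range_comp, range_ordered]
  mem_left z w hi h h' := by
    refine Submodule.smul_mem _ _ (orderedRowMinor_mem_traceSpan k _ _ fun σ => ?_)
    refine trace_ofFn_singleton ((ordered_strictMono hi).injective.comp σ.injective) ?_ ?_ <;>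
      rwa [EquivLike.range_comp, range_ordered]
  mem_right z w hi h h' := by
    refine Submodule.smul_mem _ _ (orderedRowMinor_mem_traceSpan k _ _ fun σ => ?_)
    rw [trace_comm]
    refine trace_ofFn_singleton ((ordered_strictMono hi).injective.comp σ.injective) ?_ ?_ <;>
      rwa [EquivLike.range_comp, range_ordered]
  hecke_eq hz hw h h' := by
    rw [← range_ordered] at h h'
    obtain ⟨a, ha⟩ := h
    obtain ⟨b, hb⟩ := h'
    exact toManin_hecke_smul_eq k
      (toManin_hecke_orderedRowMinor k hm _ (ordered_strictMono hw) ha hb)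
  swap_eq z w hi a b ha hb hab := by
    rw [rowMinor, rowMinor, inversions_swap_comp hm hi ha hb hab, ordered_swap_comp hi ha hb,
      smul_smul, ← add_assoc, pow_succ']

theorem isHeckeMinor_colMinor (hm : m.val + 1 = m'.val) :
    IsHeckeMinor k m m' fun _ => colMinor k where
  colSwap_eq z w hi hw := by
    rw [colMinor, colMinor, map_smul, colSwap_orderedColMinor,
      inversions_swap_comp_of_not_both hm hw, ordered_swap_comp_of_not_both hm hi hw]
  mem_nil z w h h' := by
    refine Submodule.smul_mem _ _ (orderedColMinor_mem_traceSpan k _ _ ?_)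
    refine trace_ofFn_nil ?_ ?_ <;> rwa [range_ordered]
  mem_left z w hi h h' := by
    refine Submodule.smul_mem _ _ (orderedColMinor_mem_traceSpan k _ _ ?_)
    refine trace_ofFn_singleton (ordered_strictMono hi).injective ?_ ?_ <;> rwa [range_ordered]
  mem_right z w hi h h' := by
    refine Submodule.smul_mem _ _ (orderedColMinor_mem_traceSpan k _ _ ?_)
    rw [trace_comm]
    refine trace_ofFn_singleton (ordered_strictMono hi).injective ?_ ?_ <;> rwa [range_ordered]
  hecke_eq hz hw h h' := by
    rw [← range_ordered] at h h'
    obtain ⟨a, ha⟩ := h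
    obtain ⟨b, hb⟩ := h'
    exact toManin_hecke_smul_eq k
      (toManin_hecke_orderedColMinor k hm (ordered_strictMono hz) (ordered_strictMono hw) ha hb)
  swap_eq z w hi a b ha hb hab := by
    rw [colMinor, colMinor, inversions_swap_comp hm hi ha hb hab, ordered_swap_comp hi ha hb,
      smul_smul, ← add_assoc, pow_succ']

variable {p p' : ℕ} {w : Fin p → Fin n} {w' : Fin p' → Fin n}

theorem before_iff_lt (hw : Function.Injective (Fin.append w w')) {a b : Fin (p + p')} {x y : Fin n}
    (ha : Fin.append w w' a = x) (hb : Fin.append w w' b = y) : Before w w' x y ↔ a < b := by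
  constructor
  · rintro ⟨c, d, hcd, hc, hd⟩
    rwa [hw (hc.trans ha.symm), hw (hd.trans hb.symm)] at hcd
  · exact fun h => ⟨a, b, h, ha, hb⟩

theorem swap_comp_eq_self (h : m ∉ Set.range w) (h' : m' ∉ Set.range w) :
    Equiv.swap m m' ∘ w = w := by
  ext a
  rw [Function.comp_apply, Equiv.swap_apply_of_ne_of_ne]
  · rintro rfl; exact h ⟨a, rfl⟩
  · rintro rfl; exact h' ⟨a, rfl⟩

variable {k} {μ : (p : ℕ) → (Fin p → Fin n) → (Fin p → Fin n) → FreeAlg k n}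

/-- The Hecke operator on a single minor whose columns include `m` and `m'`. -/
theorem IsHeckeMinor.toManin_hecke_eq_swap (hμ : IsHeckeMinor k m m' μ) (hne : m ≠ m')
    {z : Fin p → Fin n} (hz : Function.Injective z) (hw : Function.Injective w) {a b : Fin p} (ha : w a = m)
    (hb : w b = m') :
    toManin k n (hecke k m m' (μ p z w)) = toManin k n (μ p z (Equiv.swap m m' ∘ w)) -
      if a < b then 0 else (qInv k - q k) • toManin k n (μ p z w) := by
  rw [hμ.hecke_eq hz hw ⟨a, ha⟩ ⟨b, hb⟩]
  split_ifs with hab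
  · rw [sub_zero, hμ.swap_eq z hw ha hb hab, map_smul]
  · have hba : b ≠ a := fun e => hne (by rw [← ha, ← hb, e])
    have h := hμ.swap_eq z (w := Equiv.swap m m' ∘ w) ((Equiv.injective _).comp hw) (a := b) (b := a)
      (by simp [hb]) (by simp [ha])
      (lt_of_le_of_ne (not_lt.1 hab) hba)
    rw [← Function.comp_assoc, ← Equiv.coe_trans, Equiv.swap_swap] at h
    rw [Equiv.coe_refl, Function.id_comp] at h
    rw [h, map_smul]
    -- With `x` the swapped minor, the minor itself is `-q⁻¹ x`, and the claim is
    -- `q⁻² = 1 + (q⁻¹ - q) q⁻¹`.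
    generalize toManin k n _ = x
    have hqq := qInv_mul_q k
    rw [smul_smul, smul_smul]
    have : x - ((qInv k - q k) * -qInv k) • x = (1 + qInv k * qInv k - qInv k * q k) • x := by
      module
    rw [this, hqq]
    module

/-- The Hecke operator on a product of two minors whose columns together are all distinct and
include `m` and `m'`. -/
theorem IsHeckeMinor.toManin_hecke_mul (hμ : IsHeckeMinor k m m' μ) (hm : m.val + 1 = m'.val)
    (hp : p + p' = n) {z : Fin p → Fin n} {z' : Fin p' → Fin n} (hz : Function.Injective z)
    (hz' : Function.Injective z') (hw : Function.Injective (Fin.append w w')) :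
    toManin k n (hecke k m m' (μ p z w * μ p' z' w')) =
      toManin k n (μ p z (Equiv.swap m m' ∘ w) * μ p' z' (Equiv.swap m m' ∘ w')) -
        if Before w w' m m' then 0 else (qInv k - q k) • toManin k n (μ p z w * μ p' z' w') := by
  have hne : m ≠ m' := fun e => by rw [e] at hm; omega
  obtain ⟨hwi, hwi', hdisj⟩ := Fin.append_injective_iff.1 hw
  have hsurj : Function.Surjective (Fin.append w w') :=
    ((Fintype.bijective_iff_injective_and_card _).2 ⟨hw, by simp [hp]⟩).2
  obtain ⟨A, hA⟩ := hsurj m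
  obtain ⟨B, hB⟩ := hsurj m'
  rw [if_congr (before_iff_lt hw hA hB) rfl rfl]
  induction A using Fin.addCases with
  | left a =>
    rw [Fin.append_left] at hA
    have hA' : m ∉ Set.range w' := by rintro ⟨c, hc⟩; exact hdisj a c (hA.trans hc.symm)
    induction B using Fin.addCases with
    | left b =>
      rw [Fin.append_left] at hB
      have hB' : m' ∉ Set.range w' := by rintro ⟨c, hc⟩; exact hdisj b c (hB.trans hc.symm)
      rw [hecke_mul_right _ (hμ.mem_nil z' hA' hB'), swap_comp_eq_self hA' hB', map_mul,
        hμ.toManin_hecke_eq_swap hne hz hwi hA hB, map_mul, map_mul, sub_mul]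
      simp only [Fin.lt_def, Fin.val_castAdd, ite_mul, zero_mul, smul_mul_assoc]
    | right b =>
      rw [Fin.append_right] at hB
      have hB' : m' ∉ Set.range w := by rintro ⟨c, hc⟩; exact hdisj c b (hc.trans hB.symm)
      have hmem : μ p z w * μ p' z' w' ∈ traceSpan k m m' ([m] ++ [m']) :=
        mul_mem_traceSpan (hμ.mem_left z hwi ⟨a, hA⟩ hB') (hμ.mem_right z' hwi' ⟨b, hB⟩ hA')
      rw [List.singleton_append] at hmem
      rw [hecke_of_mem_before hmem hne, map_mul, hμ.colSwap_eq z hwi (fun h => hB' h.2),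
        hμ.colSwap_eq z' hwi' (fun h => hA' h.1), if_pos, sub_zero]
      rw [Fin.lt_def]; simp; omega
  | right a =>
    rw [Fin.append_right] at hA
    have hA' : m ∉ Set.range w := by rintro ⟨c, hc⟩; exact hdisj c a (hc.trans hA.symm)
    induction B using Fin.addCases with
    | left b =>
      rw [Fin.append_left] at hB
      have hB' : m' ∉ Set.range w' := by rintro ⟨c, hc⟩; exact hdisj b c (hB.trans hc.symm)
      have hmem : μ p z w * μ p' z' w' ∈ traceSpan k m m' ([m'] ++ [m]) :=
        mul_mem_traceSpan (hμ.mem_right z hwi ⟨b, hB⟩ hA') (hμ.mem_left z' hwi' ⟨a, hA⟩ hB')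
      rw [List.singleton_append] at hmem
      rw [hecke_of_mem_after hmem, map_mul, hμ.colSwap_eq z hwi (fun h => hA' h.1),
        hμ.colSwap_eq z' hwi' (fun h => hB' h.2), if_neg, map_sub, map_smul]
      rw [Fin.lt_def]; simp; omega
    | right b =>
      rw [Fin.append_right] at hB
      have hB' : m' ∉ Set.range w := by rintro ⟨c, hc⟩; exact hdisj c b (hc.trans hB.symm)
      rw [hecke_mul_left (hμ.mem_nil z hA' hB'), swap_comp_eq_self hA' hB', map_mul,
        hμ.toManin_hecke_eq_swap hne hz' hwi' hA hB, map_mul, map_mul, mul_sub]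
      simp only [Fin.natAdd_lt_natAdd_iff, mul_ite, mul_zero, mul_smul_comm]

end Step

/-! ### The Hecke operator of two neighbouring rows -/

section RowStep

variable (k : Type*) [Field k] {n : ℕ} (m m' : Fin n)

/-- The Hecke operator on rows.  It is the inverse of the transpose of the column operator on the
words in which each of the rows `m` and `m'` occurs exactly once. -/
noncomputable def heckeRow : FreeAlg k n →ₗ[k[T;T⁻¹]] FreeAlg k n :=
  (transpose k n).toLinearMap ∘ₗ hecke k m m' ∘ₗ (transpose k n).toLinearMap +
    (qInv k - q k) • LinearMap.id

variable {k m m'}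

theorem heckeRow_apply (x : FreeAlg k n) :
    heckeRow k m m' x = transpose k n (hecke k m m' (transpose k n x)) + (qInv k - q k) • x := rfl

theorem toManin_heckeRow_eq (hm : m.val + 1 = m'.val) {x y : FreeAlg k n}
    (h : toManin k n x = toManin k n y) :
    toManin k n (heckeRow k m m' x) = toManin k n (heckeRow k m m' y) := by
  rw [heckeRow_apply, heckeRow_apply, map_add, map_add, map_smul, map_smul, h,
    toManin_transpose_eq k (toManin_hecke_eq hm (toManin_transpose_eq k h))]

variable {p p' : ℕ} {z : Fin p → Fin n} {z' : Fin p' → Fin n}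

theorem before_comm_iff (hz : Function.Injective (Fin.append z z')) (hp : p + p' = n)
    (hne : m ≠ m') : Before z z' m' m ↔ ¬ Before z z' m m' := by
  have hsurj : Function.Surjective (Fin.append z z') :=
    ((Fintype.bijective_iff_injective_and_card _).2 ⟨hz, by simp [hp]⟩).2
  obtain ⟨A, rfl⟩ := hsurj m
  obtain ⟨B, rfl⟩ := hsurj m'
  rw [before_iff_lt hz rfl rfl, before_iff_lt hz rfl rfl, not_lt]
  exact ⟨le_of_lt, fun h => lt_of_le_of_ne h fun e => hne (by rw [e])⟩

variable {μ ν : (p : ℕ) → (Fin p → Fin n) → (Fin p → Fin n) → FreeAlg k n}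

/-- The row operator on a product of two minors whose rows together are all distinct and include
`m` and `m'`. -/
theorem IsHeckeMinor.toManin_heckeRow_mul (hν : IsHeckeMinor k m m' ν)
    (hμν : ∀ p z w, transpose k n (μ p z w) = ν p w z)
    (hνμ : ∀ p z w, transpose k n (ν p z w) = μ p w z)
    (hm : m.val + 1 = m'.val) (hp : p + p' = n) {w : Fin p → Fin n} {w' : Fin p' → Fin n}
    (hw : Function.Injective w) (hw' : Function.Injective w')
    (hz : Function.Injective (Fin.append z z')) :
    toManin k n (heckeRow k m m' (μ p z w * μ p' z' w')) =
      toManin k n (μ p (Equiv.swap m m' ∘ z) w * μ p' (Equiv.swap m m' ∘ z') w') +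
        if Before z z' m' m then 0 else (qInv k - q k) • toManin k n (μ p z w * μ p' z' w') := by
  have hne : m ≠ m' := fun e => by rw [e] at hm; omega
  have h := hν.toManin_hecke_mul hm hp hw hw' hz
  rw [heckeRow_apply, map_mul (transpose k n), hμν, hμν, map_add, map_smul]
  simp only [before_comm_iff hz hp hne]
  by_cases hb : Before z z' m m'
  · rw [if_pos hb, sub_zero] at h
    rw [toManin_transpose_eq k h, if_neg (not_not.2 hb), map_mul (transpose k n), hνμ, hνμ]
  · rw [if_neg hb, ← map_smul, ← map_sub] at h
    rw [toManin_transpose_eq k h, if_pos hb, map_sub (transpose k n), map_smul (transpose k n),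
      map_mul (transpose k n), map_mul (transpose k n), hνμ, hνμ, hνμ, hνμ, map_sub, map_smul]
    abel

end RowStep

/-! ### Commuting minors -/

section Commute

variable (k : Type*) [Field k] {n p p' : ℕ} {z w : Fin p → Fin n} {z' w' : Fin p' → Fin n}

theorem commute_toManin_word (u v : List (Fin n × Fin n))
    (h : ∀ x ∈ u, ∀ y ∈ v,
      Commute (toManin k n (gen k x.1 x.2)) (toManin k n (gen k y.1 y.2))) :
    Commute (toManin k n (word k u)) (toManin k n (word k v)) := by
  rw [word, word, map_list_prod, map_list_prod, List.map_map, List.map_map]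
  refine Commute.list_prod_left _ _ fun x hx => Commute.list_prod_right _ _ fun y hy => ?_
  obtain ⟨a, ha, rfl⟩ := List.mem_map.1 hx
  obtain ⟨b, hb, rfl⟩ := List.mem_map.1 hy
  exact h a ha b hb

theorem commute_toManin_rowMinor
    (h : ∀ a b c d, Commute (toManin k n (gen k (z a) (w b))) (toManin k n (gen k (z' c) (w' d)))) :
    Commute (toManin k n (rowMinor k z w)) (toManin k n (rowMinor k z' w')) := by
  simp only [rowMinor, orderedRowMinor_eq_sum_word, map_smul, map_sum]
  refine Commute.smul_left (Commute.smul_right (Commute.sum_left _ _ _ fun σ _ =>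
    Commute.sum_right _ _ _ fun τ _ => Commute.smul_left (Commute.smul_right ?_ _) _) _) _
  refine commute_toManin_word k _ _ fun x hx y hy => ?_
  obtain ⟨a, rfl⟩ := (List.mem_ofFn' _ _).1 hx
  obtain ⟨b, rfl⟩ := (List.mem_ofFn' _ _).1 hy
  exact h _ _ _ _

theorem commute_toManin_colMinor
    (h : ∀ a b c d, Commute (toManin k n (gen k (z a) (w b))) (toManin k n (gen k (z' c) (w' d)))) :
    Commute (toManin k n (colMinor k z w)) (toManin k n (colMinor k z' w')) := by
  simp only [colMinor, orderedColMinor_eq_sum_word, map_smul, map_sum]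
  refine Commute.smul_left (Commute.smul_right (Commute.sum_left _ _ _ fun σ _ =>
    Commute.sum_right _ _ _ fun τ _ => Commute.smul_left (Commute.smul_right ?_ _) _) _) _
  refine commute_toManin_word k _ _ fun x hx y hy => ?_
  obtain ⟨a, rfl⟩ := (List.mem_ofFn' _ _).1 hx
  obtain ⟨b, rfl⟩ := (List.mem_ofFn' _ _).1 hy
  exact h _ _ _ _

theorem commute_toManin_gen_base {r s : ℕ} (hn : r + s = n) (a b : Fin s) (c d : Fin r) :
    Commute (toManin k n (gen k (rowBaseCompl hn a) (colBaseCompl hn b)))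
      (toManin k n (gen k (rowBase hn c) (colBase hn d))) := by
  have h := toManin_eq_of_maninRel k (.comm (rowBaseCompl hn a) (colBaseCompl hn b)
    (rowBase hn c) (colBase hn d) (.inr ⟨?_, ?_⟩))
  · rwa [map_mul, map_mul] at h
  · rw [Fin.lt_def, rowBase, rowBaseCompl]; simp only; omega
  · rw [Fin.lt_def, colBase, colBaseCompl]; simp only; omega

end Commute

/-! ### Increasing sequences of index sets -/

section Sequences

variable {n p : ℕ} {m m' : Fin n}

theorem seq_strictMono {I : Finset (Fin n)} (h : I.card = p) : StrictMono (seq I h) :=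
  (I.orderEmbOfFin h).strictMono

theorem range_seq {I : Finset (Fin n)} (h : I.card = p) : Set.range (seq I h) = I :=
  I.range_orderEmbOfFin h

theorem mem_range_seq {I : Finset (Fin n)} (h : I.card = p) {x : Fin n} :
    x ∈ Set.range (seq I h) ↔ x ∈ I := by rw [range_seq, Finset.mem_coe]

theorem eq_seq {I : Finset (Fin n)} (h : I.card = p) {f : Fin p → Fin n} (hf : ∀ x, f x ∈ I)
    (hmono : StrictMono f) : f = seq I h :=
  Finset.orderEmbOfFin_unique h hf hmono

theorem mem_map_swap {I : Finset (Fin n)} {x : Fin n} :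
    x ∈ I.map (Equiv.swap m m').toEmbedding ↔ Equiv.swap m m' x ∈ I := by
  rw [Finset.mem_map_equiv, Equiv.symm_swap]

/-- A transposition of neighbours that moves a set of indices carries the increasing sequence of
the one set to the increasing sequence of the other. -/
theorem swap_comp_seq (hm : m.val + 1 = m'.val) {I K : Finset (Fin n)} (hI : I.card = p)
    (hK : K.card = p) (hIK : ∀ x, x ∈ K ↔ Equiv.swap m m' x ∈ I) (hmm : ¬ (m ∈ I ∧ m' ∈ I)) :
    Equiv.swap m m' ∘ seq K hK = seq I hI := by
  refine eq_seq hI (fun x => (hIK _).1 ((mem_range_seq hK).1 ⟨x, rfl⟩)) fun a b hab => ?_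
  refine (swap_comp_lt_iff hm ?_ _ _).2 (seq_strictMono hK hab)
  rw [mem_range_seq, mem_range_seq, hIK, hIK, Equiv.swap_apply_left, Equiv.swap_apply_right]
  exact fun h => hmm h.symm

theorem append_seq_injective {r s : ℕ} {I K : Finset (Fin n)} (hI : I.card = r) (hK : K.card = s)
    (h : Disjoint I K) : Function.Injective (Fin.append (seq I hI) (seq K hK)) := by
  refine Fin.append_injective_iff.2 ⟨(seq_strictMono hI).injective, (seq_strictMono hK).injective,
    fun i j e => ?_⟩
  exact Finset.disjoint_left.1 h ((mem_range_seq hI).1 ⟨i, rfl⟩)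
    ((mem_range_seq hK).1 ⟨j, e.symm⟩)

theorem before_seq {r s : ℕ} {I K : Finset (Fin n)} (hI : I.card = r) (hK : K.card = s)
    (h : m ∈ I) (h' : m' ∈ K) : Before (seq I hI) (seq K hK) m m' := by
  obtain ⟨a, ha⟩ := (mem_range_seq hI).2 h
  obtain ⟨b, hb⟩ := (mem_range_seq hK).2 h'
  refine ⟨Fin.castAdd s a, Fin.natAdd r b, ?_, by simpa using ha, by simpa using hb⟩
  rw [Fin.lt_def]; simp; omega

end Sequences

/-! ### Bottom and steps of the standard towers -/

section Bases

variable {n r s : ℕ} (hn : r + s = n)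

/-- A set without row gaps is a lower set. -/
theorem mem_of_rowGaps_eq_empty {I : Finset (Fin n)} (h : rowGaps I = ∅) {i j : Fin n}
    (hi : i ∈ I) (hji : j ≤ i) : j ∈ I := by
  obtain ⟨d, hd⟩ := Nat.exists_eq_add_of_le (Fin.le_def.1 hji)
  induction d generalizing j with
  | zero => rwa [show j = i from Fin.ext (by omega)]
  | succ d ih =>
    have hj : (⟨j.val + 1, by omega⟩ : Fin n) ∈ I :=
      ih (Fin.le_def.2 (by simp only; omega)) (by simp only; omega)
    by_contra hjI
    exact Finset.eq_empty_iff_forall_notMem.1 h _ (Finset.mem_filter.2 ⟨hj, j, rfl, hjI⟩)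

/-- A set without column gaps is an upper set. -/
theorem mem_of_colGaps_eq_empty {J : Finset (Fin n)} (h : colGaps J = ∅) {i j : Fin n}
    (hi : i ∈ J) (hij : i ≤ j) : j ∈ J := by
  obtain ⟨d, hd⟩ := Nat.exists_eq_add_of_le (Fin.le_def.1 hij)
  induction d generalizing j with
  | zero => rwa [show j = i from Fin.ext (by omega)]
  | succ d ih =>
    have hj : (⟨j.val - 1, by omega⟩ : Fin n) ∈ J :=
      ih (Fin.le_def.2 (by simp only; omega)) (by simp only; omega)
    by_contra hjJ
    refine Finset.eq_empty_iff_forall_notMem.1 h _ (Finset.mem_filter.2 ⟨hj, j, ?_, hjJ⟩)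
    simp only; omega

theorem seq_eq_rowBase {I : Finset (Fin n)} (hI : I.card = r) (h : rowGaps I = ∅) :
    seq I hI = rowBase hn := by
  refine (eq_seq hI (fun x => ?_) fun a b hab => hab).symm
  by_contra hx
  have hsub : I ⊆ Finset.Iio (rowBase hn x) := fun i hi => by
    rw [Finset.mem_Iio]
    by_contra hle
    exact hx (mem_of_rowGaps_eq_empty h hi (not_lt.1 hle))
  have := Finset.card_le_card hsub
  rw [Fin.card_Iio, hI, rowBase] at this
  simp only at this
  omega

theorem seq_compl_eq_rowBaseCompl {I : Finset (Fin n)} (hI : I.card = r) (h : rowGaps I = ∅) :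
    seq Iᶜ (card_compl_eq hn hI) = rowBaseCompl hn := by
  refine (eq_seq _ (fun x => ?_) fun a b hab => ?_).symm
  · rw [Finset.mem_compl]
    intro hx
    have hsub : Finset.Iic (rowBaseCompl hn x) ⊆ I := fun i hi =>
      mem_of_rowGaps_eq_empty h hx (Finset.mem_Iic.1 hi)
    have := Finset.card_le_card hsub
    rw [Fin.card_Iic, hI, rowBaseCompl] at this
    simp only at this
    omega
  · rw [Fin.lt_def] at hab ⊢
    simp only [rowBaseCompl]; omega

theorem seq_eq_colBase {J : Finset (Fin n)} (hJ : J.card = r) (h : colGaps J = ∅) :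
    seq J hJ = colBase hn := by
  refine (eq_seq hJ (fun x => ?_) fun a b hab => ?_).symm
  · by_contra hx
    have hsub : J ⊆ Finset.Ioi (colBase hn x) := fun i hi => by
      rw [Finset.mem_Ioi]
      by_contra hle
      exact hx (mem_of_colGaps_eq_empty h hi (not_lt.1 hle))
    have := Finset.card_le_card hsub
    rw [Fin.card_Ioi, hJ, colBase] at this
    simp only at this
    omega
  · rw [Fin.lt_def] at hab ⊢
    simp only [colBase]; omega

theorem seq_compl_eq_colBaseCompl {J : Finset (Fin n)} (hJ : J.card = r) (h : colGaps J = ∅) :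
    seq Jᶜ (card_compl_eq hn hJ) = colBaseCompl hn := by
  refine (eq_seq _ (fun x => ?_) fun a b hab => ?_).symm
  · rw [Finset.mem_compl]
    intro hx
    have hsub : Finset.Ici (colBaseCompl hn x) ⊆ J := fun i hi =>
      mem_of_colGaps_eq_empty h hx (Finset.mem_Ici.1 hi)
    have := Finset.card_le_card hsub
    rw [Fin.card_Ici, hJ, colBaseCompl] at this
    simp only at this
    omega
  · rw [Fin.lt_def] at hab ⊢
    simpa only [colBaseCompl] using hab

theorem rowTransposition_spec (I : Finset (Fin n)) (h : (rowGaps I).Nonempty) :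
    (rowTransposition I h).1.val + 1 = (rowTransposition I h).2.val ∧
      (rowTransposition I h).1 ∉ I ∧ (rowTransposition I h).2 ∈ I := by
  obtain ⟨hi, m, hm, hmI⟩ := Finset.mem_filter.1 ((rowGaps I).min'_mem h)
  have e : (rowTransposition I h).1 = m := Fin.ext (by simp only [rowTransposition]; omega)
  exact ⟨e ▸ hm, e ▸ hmI, hi⟩

theorem colTransposition_spec (J : Finset (Fin n)) (h : (colGaps J).Nonempty) :
    (colTransposition J h).1.val + 1 = (colTransposition J h).2.val ∧
      (colTransposition J h).1 ∈ J ∧ (colTransposition J h).2 ∉ J := by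
  obtain ⟨hi, m, hm, hmJ⟩ := Finset.mem_filter.1 ((colGaps J).max'_mem h)
  have e : (colTransposition J h).2 = m := Fin.ext hm
  exact ⟨rfl, hi, e ▸ hmJ⟩

end Bases

/-! ### The index families -/

section Families

variable {n r s : ℕ} (hn : r + s = n)

theorem colFamily_eq_nil (τ : List (Fin n × Fin n)) {i : ℕ} (hi : τ.length < i) :
    colFamily hn τ i = [] := by
  induction τ generalizing i with
  | nil => obtain ⟨i, rfl⟩ := Nat.exists_eq_succ_of_ne_zero hi.ne_bot; rfl
  | cons σ τ ih =>
    obtain ⟨i, rfl⟩ := Nat.exists_eq_succ_of_ne_zero hi.ne_bot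
    simp only [List.length_cons] at hi
    simp [colFamily, ih (show τ.length < i by omega), ih (show τ.length < i + 1 by omega)]

theorem rowFamily_eq_nil (cols τ : List (Fin n × Fin n)) {i : ℕ}
    (hi : cols.length + τ.length < i) : rowFamily hn cols τ i = [] := by
  induction τ generalizing i with
  | nil => simp [rowFamily, colFamily_eq_nil hn cols (show cols.length < i by simpa using hi)]
  | cons σ τ ih =>
    obtain ⟨i, rfl⟩ := Nat.exists_eq_succ_of_ne_zero hi.ne_bot
    simp only [List.length_cons] at hi
    simp [rowFamily, ih (show cols.length + τ.length < i by omega),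
      ih (show cols.length + τ.length < i + 1 by omega)]

theorem append_perm_comp_injective (σ : Equiv.Perm (Fin n)) {u : Fin r → Fin n} {u' : Fin s → Fin n}
    (h : Function.Injective (Fin.append u u')) :
    Function.Injective (Fin.append (σ ∘ u) (σ ∘ u')) := by
  rw [Fin.append_injective_iff] at h ⊢
  exact ⟨σ.injective.comp h.1, σ.injective.comp h.2.1, fun i j => σ.injective.ne (h.2.2 i j)⟩

theorem append_rowBase_injective :
    Function.Injective (Fin.append (rowBase hn) (rowBaseCompl hn)) := by
  refine Fin.append_injective_iff.2 ⟨fun a b h => ?_, fun a b h => ?_, fun a b h => ?_⟩ <;>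
  · simp only [rowBase, rowBaseCompl, Fin.mk.injEq] at h
    omega

theorem append_colBase_injective :
    Function.Injective (Fin.append (colBase hn) (colBaseCompl hn)) := by
  refine Fin.append_injective_iff.2 ⟨fun a b h => ?_, fun a b h => ?_, fun a b h => ?_⟩ <;>
  · simp only [colBase, colBaseCompl, Fin.mk.injEq] at h
    omega

theorem append_injective_of_mem_colFamily (τ : List (Fin n × Fin n)) {i : ℕ} {c : ColPair n r s}
    (hc : c ∈ colFamily hn τ i) : Function.Injective (Fin.append c.W c.W') := by
  have hmap : ∀ (σ : Fin n × Fin n) (l : List (ColPair n r s)),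
      (∀ c ∈ l, Function.Injective (Fin.append c.W c.W')) →
      ∀ c ∈ l.map (ColPair.act (transp σ)), Function.Injective (Fin.append c.W c.W') := by
    intro σ l hl c hc
    obtain ⟨d, hd, rfl⟩ := List.mem_map.1 hc
    exact append_perm_comp_injective _ (hl d hd)
  induction τ generalizing i c with
  | nil =>
    cases i with
    | zero =>
      rw [colFamily, List.mem_singleton] at hc
      subst hc
      exact append_colBase_injective hn
    | succ i => simp [colFamily] at hc
  | cons σ τ ih =>
    cases i with
    | zero => exact hmap σ _ (fun c => ih) c hc
    | succ i =>
      rcases List.mem_append.1 hc with h | h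
      · exact ih (List.mem_filter.1 h).1
      · exact hmap σ _ (fun c => ih) c h

theorem append_injective_of_mem_rowFamily (cols τ : List (Fin n × Fin n)) {i : ℕ}
    {e : SignedIndex n r s} (he : e ∈ rowFamily hn cols τ i) :
    Function.Injective (Fin.append e.Z e.Z') ∧ Function.Injective (Fin.append e.W e.W') := by
  have hmap : ∀ (σ : Fin n × Fin n) (l : List (SignedIndex n r s)),
      (∀ e ∈ l, Function.Injective (Fin.append e.Z e.Z') ∧
        Function.Injective (Fin.append e.W e.W')) →
      ∀ e ∈ l.map (SignedIndex.rowAct (transp σ)), Function.Injective (Fin.append e.Z e.Z') ∧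
        Function.Injective (Fin.append e.W e.W') := by
    intro σ l hl c hc
    obtain ⟨d, hd, rfl⟩ := List.mem_map.1 hc
    exact ⟨append_perm_comp_injective _ (hl d hd).1, (hl d hd).2⟩
  induction τ generalizing i e with
  | nil =>
    rw [rowFamily] at he
    obtain ⟨c, hc, rfl⟩ := List.mem_map.1 he
    exact ⟨append_rowBase_injective hn, append_injective_of_mem_colFamily hn cols hc⟩
  | cons σ τ ih =>
    cases i with
    | zero => exact hmap σ _ (fun c => ih) e he
    | succ i =>
      rcases List.mem_append.1 he with h | h
      · exact ih (List.mem_filter.1 h).1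
      · exact hmap σ _ (fun c => ih) e h

end Families

/-! ### Sums over graded families -/

section FamilySum

variable {R A B E : Type*} [CommRing R] [AddCommGroup A] [Module R A] [AddCommGroup B] [Module R B]

/-- The sum of the values `val` over the members of a graded family of lists `C`, in which degree
`i ≤ L` is weighted by `h ^ i`. -/
def familySum (h : R) (L : ℕ) (C : ℕ → List E) (val : E → A) : A :=
  ∑ i ∈ Finset.range (L + 1), h ^ i • ((C i).map val).sum

theorem map_familySum (g : A →ₗ[R] B) (h : R) (L : ℕ) (C : ℕ → List E) (val : E → A) :
    g (familySum h L C val) = familySum h L C fun e => g (val e) := by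
  simp only [familySum, map_sum, map_smul, map_list_sum, List.map_map, Function.comp_def]

theorem sum_map_ite (l : List E) (P : E → Prop) [DecidablePred P] (val : E → A) :
    (l.map fun e => if P e then val e else 0).sum = ((l.filter P).map val).sum := by
  induction l with
  | nil => rfl
  | cons e l ih => by_cases h : P e <;> simp [h, ih]

/-- The recursion of the index families, seen on sums: a step that replaces each member `e` by its
image `f e` and, one degree higher, by `e` itself if `P e` holds. -/
theorem familySum_step (h : R) (L : ℕ) {C C' : ℕ → List E} (f : E → E) (P : E → Prop)
    [DecidablePred P] (h0 : C' 0 = (C 0).map f)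
    (hs : ∀ i, C' (i + 1) = (C i).filter P ++ (C (i + 1)).map f) (hL : C (L + 1) = [])
    {val val' : E → A}
    (hval : ∀ i, ∀ e ∈ C i, val' e = val (f e) + if P e then h • val e else 0) :
    familySum h (L + 1) C' val = familySum h L C val' := by
  have h1 : ∀ i, ((C i).map val').sum =
      ((C i).map fun e => val (f e)).sum + h • (((C i).filter P).map val).sum := by
    intro i
    rw [List.map_congr_left (hval i), List.sum_map_add, sum_map_ite (C i) P, List.smul_sum,
      List.map_map]
    rfl
  -- The image of the top degree `L + 1` of `C` is empty, so that it may be added.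
  have h2 : ∑ i ∈ Finset.range (L + 2), h ^ i • ((C i).map fun e => val (f e)).sum =
      ∑ i ∈ Finset.range (L + 1), h ^ i • ((C i).map fun e => val (f e)).sum := by
    rw [Finset.sum_range_succ, hL]; simp
  rw [familySum, familySum, Finset.sum_range_succ']
  simp only [hs, h0, h1, List.map_append, List.sum_append, smul_add, Finset.sum_add_distrib,
    List.map_map, Function.comp_def]
  rw [← h2, Finset.sum_range_succ' _ (L + 1)]
  simp only [pow_succ, mul_smul]
  abel

/-- Alternating signs of the members amount to a change of sign of the weight. -/
theorem familySum_neg {E' : Type*} (h : R) (L : ℕ) (C : ℕ → List E) (F : ℕ → E → E')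
    (val : E' → A) (val' : E → A)
    (hval : ∀ i e, val (F i e) = ((-1 : ℤ) ^ i) • val' e) :
    familySum h L (fun i => (C i).map (F i)) val = familySum (-h) L C val' := by
  refine Finset.sum_congr rfl fun i _ => ?_
  have : val ∘ F i = (fun x : A => ((-1 : ℤ) ^ i) • x) ∘ val' := funext (hval i)
  rw [List.map_map, this, ← List.map_map, ← List.smul_sum, neg_pow h i, mul_comm, mul_smul,
    ← Int.cast_smul_eq_zsmul R]
  simp

end FamilySum

/-! ### The expansion along the towers -/

section Expansion

variable {k : Type*} [Field k] {n r s : ℕ} (hn : r + s = n)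
  {μ ν : (p : ℕ) → (Fin p → Fin n) → (Fin p → Fin n) → FreeAlg k n}

/-- The expansion for the rows `I₀ = (1 … r)`, by applying along the column tower the Hecke
operators of the columns to both sides of the commutation relation for `J₀`. -/
theorem toManin_expansion_rowBase
    (hμ : ∀ m m' : Fin n, m.val + 1 = m'.val → IsHeckeMinor k m m' μ)
    (hbase : Commute (toManin k n (μ s (rowBaseCompl hn) (colBaseCompl hn)))
      (toManin k n (μ r (rowBase hn) (colBase hn))))
    (J : Finset (Fin n)) (hJ : J.card = r) :
    toManin k n (μ s (rowBaseCompl hn) (seq Jᶜ (card_compl_eq hn hJ)) *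
        μ r (rowBase hn) (seq J hJ)) =
      familySum (-(qInv k - q k)) (colTower J).length (colFamily hn (colTower J)) fun c =>
        toManin k n (μ r (rowBase hn) c.W * μ s (rowBaseCompl hn) c.W') := by
  induction J using colTower.induct with
  | case1 J h ih =>
    obtain ⟨hσ, h1, h2⟩ := colTransposition_spec J h
    have hJ' : (J.map (transp (colTransposition J h)).toEmbedding).card = r := by
      rw [Finset.card_map, hJ]
    rw [colTower, dif_pos h]
    have IH := ih hJ'
    generalize colTransposition J h = σ at *
    set K := J.map (transp σ).toEmbedding
    set τ := colTower K
    have hmem : ∀ x, x ∈ K ↔ Equiv.swap σ.1 σ.2 x ∈ J := fun x => mem_map_swap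
    have IH' := IH.trans (map_familySum (toManin k n).toLinearMap _ _ _ _).symm
    -- The operator of the column step, applied to both sides of the expansion for `K`.
    have IH'' := (toManin_hecke_eq hσ IH').trans
      (map_familySum ((toManin k n).toLinearMap ∘ₗ hecke k σ.1 σ.2) _ _ _ _)
    have hz := Fin.append_injective_iff.1 (append_rowBase_injective hn)
    -- On the left `m` lies in the first factor and `m'` in the second: no correction term.
    rw [(hμ _ _ hσ).toManin_hecke_mul hσ (by omega) hz.2.1 hz.1
        (append_seq_injective _ _ disjoint_compl_left),
      if_pos (before_seq _ _ (by rw [Finset.mem_compl, hmem, Equiv.swap_apply_left]; exact h2)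
        (by rw [hmem, Equiv.swap_apply_right]; exact h1)), sub_zero,
      swap_comp_seq hσ hJ hJ' hmem (fun h => h2 h.2),
      swap_comp_seq hσ (card_compl_eq hn hJ) (card_compl_eq hn hJ')
        (fun x => by rw [Finset.mem_compl, Finset.mem_compl, hmem])
        (fun h => Finset.mem_compl.1 h.1 h1)] at IH''
    rw [IH'', List.length_cons]
    symm
    refine familySum_step _ _ (ColPair.act (transp σ)) (fun c => ¬ Before c.W c.W' σ.1 σ.2)
      rfl (fun i => rfl) (colFamily_eq_nil hn τ (Nat.lt_succ_self _)) fun i c hc => ?_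
    refine ((hμ _ _ hσ).toManin_hecke_mul hσ hn hz.1 hz.2.1
      (append_injective_of_mem_colFamily hn τ hc)).trans ?_
    by_cases hb : Before c.W c.W' σ.1 σ.2
    · rw [if_pos hb, if_neg (not_not.2 hb), sub_zero, add_zero]; rfl
    · rw [if_neg hb, if_pos hb, neg_smul, sub_eq_add_neg]; rfl
  | case2 J h =>
    have h0 := Finset.not_nonempty_iff_eq_empty.1 h
    rw [colTower, dif_neg h, seq_eq_colBase hn hJ h0, seq_compl_eq_colBaseCompl hn hJ h0, map_mul,
      hbase.eq]
    simp [familySum, colFamily]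

/-- The expansion of a product of complementary minors, by applying along the row tower the Hecke
operators of the rows to both sides of the expansion for the rows `I₀`. -/
theorem toManin_expansion
    (hμ : ∀ m m' : Fin n, m.val + 1 = m'.val → IsHeckeMinor k m m' μ)
    (hν : ∀ m m' : Fin n, m.val + 1 = m'.val → IsHeckeMinor k m m' ν)
    (hμν : ∀ p z w, transpose k n (μ p z w) = ν p w z)
    (hνμ : ∀ p z w, transpose k n (ν p z w) = μ p w z)
    (hbase : Commute (toManin k n (μ s (rowBaseCompl hn) (colBaseCompl hn)))
      (toManin k n (μ r (rowBase hn) (colBase hn))))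
    (I J : Finset (Fin n)) (hI : I.card = r) (hJ : J.card = r) :
    toManin k n (μ s (seq Iᶜ (card_compl_eq hn hI)) (seq Jᶜ (card_compl_eq hn hJ)) *
        μ r (seq I hI) (seq J hJ)) =
      familySum (qInv k - q k) ((colTower J).length + (rowTower I).length)
        (rowFamily hn (colTower J) (rowTower I)) fun e =>
          toManin k n (e.sign • (μ r e.Z e.W * μ s e.Z' e.W')) := by
  induction I using rowTower.induct with
  | case1 I h ih =>
    obtain ⟨hσ, h1, h2⟩ := rowTransposition_spec I h
    have hI' : (I.map (transp (rowTransposition I h)).toEmbedding).card = r := by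
      rw [Finset.card_map, hI]
    rw [rowTower, dif_pos h]
    have IH := ih hI'
    generalize rowTransposition I h = σ at *
    set K := I.map (transp σ).toEmbedding
    set τ := rowTower K
    have hmem : ∀ x, x ∈ K ↔ Equiv.swap σ.1 σ.2 x ∈ I := fun x => mem_map_swap
    have IH' := IH.trans (map_familySum (toManin k n).toLinearMap _ _ _ _).symm
    -- The operator of the row step, applied to both sides of the expansion for `K`.
    have IH'' := (toManin_heckeRow_eq hσ IH').trans
      (map_familySum ((toManin k n).toLinearMap ∘ₗ heckeRow k σ.1 σ.2) _ _ _ _)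
    -- On the left `m'` lies in the first factor and `m` in the second: no correction term.
    rw [(hν _ _ hσ).toManin_heckeRow_mul hμν hνμ hσ (by omega) (seq_strictMono _).injective
        (seq_strictMono _).injective (append_seq_injective _ _ disjoint_compl_left),
      if_pos (before_seq _ _ (by rw [Finset.mem_compl, hmem, Equiv.swap_apply_right]; exact h1)
        (by rw [hmem, Equiv.swap_apply_left]; exact h2)), add_zero,
      swap_comp_seq hσ hI hI' hmem (fun h => h1 h.1),
      swap_comp_seq hσ (card_compl_eq hn hI) (card_compl_eq hn hI')
        (fun x => by rw [Finset.mem_compl, Finset.mem_compl, hmem])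
        (fun h => Finset.mem_compl.1 h.2 h2)] at IH''
    rw [IH'', List.length_cons, ← add_assoc]
    symm
    refine familySum_step _ _ (SignedIndex.rowAct (transp σ)) (fun e => ¬ Before e.Z e.Z' σ.2 σ.1)
      rfl (fun i => rfl) (rowFamily_eq_nil hn _ τ (Nat.lt_succ_self _)) fun i e he => ?_
    obtain ⟨hZ, hW⟩ := append_injective_of_mem_rowFamily hn _ τ he
    have hW' := Fin.append_injective_iff.1 hW
    have key := (hν _ _ hσ).toManin_heckeRow_mul hμν hνμ hσ hn hW'.1 hW'.2.1 hZ
    change toManin k n (heckeRow k σ.1 σ.2 (e.sign • (μ r e.Z e.W * μ s e.Z' e.W'))) =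
      toManin k n (e.sign • (μ r (transp σ ∘ e.Z) e.W * μ s (transp σ ∘ e.Z') e.W')) + _
    simp only [map_zsmul, key]
    by_cases hb : Before e.Z e.Z' σ.2 σ.1
    · rw [if_pos hb, if_neg (not_not.2 hb), add_zero, add_zero]
    · rw [if_neg hb, if_pos hb, zsmul_add]
      exact congrArg _ (map_zsmul (DistribSMul.toAddMonoidHom
        (maninIdeal k n).ringCon.Quotient (qInv k - q k)) _ _).symm
  | case2 I h =>
    have h0 := Finset.not_nonempty_iff_eq_empty.1 h
    rw [rowTower, dif_neg h, seq_eq_rowBase hn hI h0, seq_compl_eq_rowBaseCompl hn hI h0,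
      toManin_expansion_rowBase hn hμ hbase]
    symm
    exact familySum_neg _ _ _ _ _ _ fun i c => map_zsmul _ _ _

end Expansion

end QuantumMinors

open QuantumMinors in
theorem mainTheorem1 (k : Type*) [Field k] (n r s : ℕ) (hn : r + s = n)
    (I J : Finset (Fin n)) (hI : I.card = r) (hJ : J.card = r) :
    Congr k
      (rowMinor k (seq Iᶜ (card_compl_eq hn hI)) (seq Jᶜ (card_compl_eq hn hJ)) *
        rowMinor k (seq I hI) (seq J hJ))
      (∑ i ∈ Finset.range (intc J + intr I + 1), (qInv k - q k) ^ i •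
        ((indexFamily hn I J i).map fun e =>
          e.sign • (rowMinor k e.Z e.W * rowMinor k e.Z' e.W')).sum) ∧
    Congr k
      (colMinor k (seq Iᶜ (card_compl_eq hn hI)) (seq Jᶜ (card_compl_eq hn hJ)) *
        colMinor k (seq I hI) (seq J hJ))
      (∑ i ∈ Finset.range (intc J + intr I + 1), (qInv k - q k) ^ i •
        ((indexFamily hn I J i).map fun e =>
          e.sign • (colMinor k e.Z e.W * colMinor k e.Z' e.W')).sum) := by
  rw [congr_iff_toManin_eq, congr_iff_toManin_eq]
  constructor
  · refine (toManin_expansion hn (μ := fun _ => rowMinor k) (ν := fun _ => colMinor k)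
      (fun _ _ => isHeckeMinor_rowMinor k) (fun _ _ => isHeckeMinor_colMinor k)
      (fun _ => transpose_rowMinor k) (fun _ => transpose_colMinor k)
      (commute_toManin_rowMinor k (commute_toManin_gen_base k hn)) I J hI hJ).trans ?_
    exact (map_familySum (toManin k n).toLinearMap _ _ _ _).symm
  · refine (toManin_expansion hn (μ := fun _ => colMinor k) (ν := fun _ => rowMinor k)
      (fun _ _ => isHeckeMinor_colMinor k) (fun _ _ => isHeckeMinor_rowMinor k)
      (fun _ => transpose_colMinor k) (fun _ => transpose_rowMinor k)
      (commute_toManin_colMinor k (commute_toManin_gen_base k hn)) I J hI hJ).trans ?_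
    exact (map_familySum (toManin k n).toLinearMap _ _ _ _).symm
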